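/- Let $T \ge 1$ be an integer and let $g = (g_t)_{t\in\mathbb{Z}}$ be a $T$-periodic sequence of complex numbers, i.e. $g_{t+T}=g_t$ for all $t\in\mathbb{Z}$. Let $$C^g = (g_{i-j})_{i,j=1}^{T} = \begin{bmatrix} g_0 & g_{T-1} & \dots & g_1\\ g_1 & g_0 & \dots & g_2\\ \vdots & \vdots & & \vdots\\ g_{T-1} & g_{T-2} & \dots & g_0\end{bmatrix}\in\mathbb{C}^{T\times T}$$ be the associated circulant matrix. For $1\le k\le \min\{m,n\}$, a matrix $X\in\mathbb{C}^{m\times n}$ is called $k$-sign consistent if all its $k$-minors (the determinants of the submatrices formed by $k$ rows and $k$ columns, taken in increasing order) share the same sign, that is, if they are all real and nonnegative or all real and nonpositive. Let $k\in\{1,\dots,T\}$ be odd with $2k\ge T+1$. Then the following are equivalent: 1. $C^g$ is $k$-sign consistent. 2. The $k\times T$ submatrix $C^g_{((1:k),:)}$ formed by the first $k$ rows of $C^g$ is $k$-sign consistent. -/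

import Mathlib

open scoped ComplexOrder

/-- The Toeplitz matrix `T^g(t, m, n)`: the `m × n` matrix whose `(i, j)` entry
(indices counted from `0`) is `g (t + i - j)`. -/
def toeplitzMatrix (g : ℤ → ℂ) (t : ℤ) (m n : ℕ) : Matrix (Fin m) (Fin n) ℂ :=
  Matrix.of fun i j => g (t + (i : ℤ) - (j : ℤ))

/-- The circulant matrix `C^g = T^g(0, T, T)` of a `T`-periodic sequence `g`. -/
def circulantMatrix (g : ℤ → ℂ) (T : ℕ) : Matrix (Fin T) (Fin T) ℂ :=
  toeplitzMatrix g 0 T T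

/-- For a `T`-periodic sequence this is Mathlib's circulant matrix with first column
`g 0, …, g (T - 1)`. -/
theorem circulantMatrix_eq_circulant {g : ℤ → ℂ} {T : ℕ} (hg : Function.Periodic g (T : ℤ)) :
    circulantMatrix g T = Matrix.circulant fun i : Fin T => g ((i : ℕ) : ℤ) := by
  ext i j
  simp only [circulantMatrix, toeplitzMatrix, Matrix.of_apply, Matrix.circulant_apply]
  rw [Fin.intCast_val_sub_eq_sub_add_ite]
  split_ifs with h
  · simp
  · rw [← hg]
    congr 1
    ring

/-- The matrix `X` is `k`-sign consistent: its `k`-minors are real and share the same (weak)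
sign. In the order on `ℂ` used here, `0 ≤ z` means that `z` is real and nonnegative. The rows and
the columns of a minor are selected by strictly increasing maps `p` and `q`. -/
def IsSignConsistent (k : ℕ) {m n : ℕ} (X : Matrix (Fin m) (Fin n) ℂ) : Prop :=
  (∀ (p : Fin k ↪o Fin m) (q : Fin k ↪o Fin n), 0 ≤ (X.submatrix p q).det) ∨
    (∀ (p : Fin k ↪o Fin m) (q : Fin k ↪o Fin n), (X.submatrix p q).det ≤ 0)

/-- The submatrix `X_{((1:k), :)}` formed by the first `k` rows of `X`. -/
def firstRows {m n k : ℕ} (hk : k ≤ m) (X : Matrix (Fin m) (Fin n) ℂ) :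
    Matrix (Fin k) (Fin n) ℂ :=
  X.submatrix (Fin.castLE hk) id

/-! A cycle of odd length k is even. Hence for strictly increasing integer tuples inside windows of
length T (`CycMono`), `toeplitzMinor` equals a minor of C^g, sign included
(`CycMono.exists_orderEmb`). The point is to pass from nonnegative minors in k consecutive rows to
nonnegativity of all minors; the nonpositive case follows by negating g, as k is odd.

Convolution with 1 + a z, a ≥ 0, turns a minor into a combination of minors with some columns raised
by one. These tuples are again `CycMono` or give zero, so nonnegativity in fixed rows is preserved.
Under convolution with (1 + z)^(2n), where k = 2m + 1, the frequencies -m, …, m dominate. Up to a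
positive factor, the minor with columns shifted by -n tends to a positive product of chords for p
and q, times the product of the k low Fourier coefficients. That product is positive as soon as some
consecutive-row minor is nonzero (`prod_coeff_low_pos`): up to a positive factor it is a sum of
consecutive-row minors weighted by chord products. So all minors eventually become positive
(`exists_iterate_toeplitzMinor_pos`).

The way back, for positive consecutive-row minors, removes one factor 1 + z at a time by deforming
it to 1 + a z with a decreasing from 1 to 0. Where positivity would first fail, all minors are still
nonnegative, and a three-term Plücker relation makes them positive (`toeplitzMinor_pos_of_nonneg`).
In the merely nonnegative case, g is first convolved with (1 + a z)^(2N), which makes the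
consecutive-row minors positive, and then a → 0.

If all consecutive-row minors vanish, so do all minors: the consecutive-row minors determine the
products of k Fourier coefficients at distinct frequencies, hence every minor
(`toeplitzMinor_eq_of_consecutive_rows`). The same fact shows that all minors are real. -/

/-- The minor of the bi-infinite Toeplitz matrix `(g (a - b))` with rows `p` and columns `q`. -/
def toeplitzMinor (g : ℤ → ℂ) {k : ℕ} (p q : Fin k → ℤ) : ℂ :=
  (Matrix.of fun i j => g (p i - q j)).det

/-- The tuple `q` is strictly increasing and its entries lie in a window of length `T`. -/
structure CycMono (T : ℕ) {k : ℕ} (q : Fin k → ℤ) : Prop where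
  strictMono : StrictMono q
  lt_add : ∀ i j, q i < q j + T

/-- Modulo `T`, the tuple `q'` is an even rearrangement of `q`. -/
def EvenRearr (T : ℕ) {k : ℕ} (q q' : Fin k → ℤ) : Prop :=
  ∃ σ : Equiv.Perm (Fin k), Equiv.Perm.sign σ = 1 ∧ ∀ i, (T : ℤ) ∣ q (σ i) - q' i

/-! ### Toeplitz minors modulo T -/

section Basic

variable {T k : ℕ} {g : ℤ → ℂ}

theorem Function.Periodic.eq_of_dvd_sub (hg : Function.Periodic g (T : ℤ)) {a b : ℤ}
    (h : (T : ℤ) ∣ a - b) : g a = g b := by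
  obtain ⟨c, hc⟩ := h
  have := hg.int_mul c b
  rw [show a = b + c * T by linarith]
  simpa using this

theorem toeplitzMinor_comm (g : ℤ → ℂ) (p q : Fin k → ℤ) :
    toeplitzMinor (fun t => g (-t)) q p = toeplitzMinor g p q := by
  rw [toeplitzMinor, toeplitzMinor, ← Matrix.det_transpose]
  congr 1
  ext i j
  simp

theorem toeplitzMinor_perm_right (g : ℤ → ℂ) (p q : Fin k → ℤ) (σ : Equiv.Perm (Fin k)) :
    toeplitzMinor g p (q ∘ σ) = Equiv.Perm.sign σ * toeplitzMinor g p q := by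
  rw [toeplitzMinor, toeplitzMinor, ← Matrix.det_permute']
  rfl

theorem toeplitzMinor_perm_left (g : ℤ → ℂ) (p q : Fin k → ℤ) (σ : Equiv.Perm (Fin k)) :
    toeplitzMinor g (p ∘ σ) q = Equiv.Perm.sign σ * toeplitzMinor g p q := by
  rw [toeplitzMinor, toeplitzMinor, ← Matrix.det_permute]
  rfl

theorem toeplitzMinor_congr_right (hg : Function.Periodic g (T : ℤ)) (p : Fin k → ℤ)
    {q q' : Fin k → ℤ} (h : ∀ i, (T : ℤ) ∣ q i - q' i) :
    toeplitzMinor g p q = toeplitzMinor g p q' := by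
  unfold toeplitzMinor
  congr 1
  ext i j
  refine hg.eq_of_dvd_sub ?_
  rw [show p i - q j - (p i - q' j) = -(q j - q' j) by ring]
  exact (h j).neg_right

theorem toeplitzMinor_eq_zero_of_dvd (hg : Function.Periodic g (T : ℤ)) (p : Fin k → ℤ)
    {q : Fin k → ℤ} {i j : Fin k} (hij : i ≠ j) (h : (T : ℤ) ∣ q i - q j) :
    toeplitzMinor g p q = 0 := by
  refine Matrix.det_zero_of_column_eq hij fun l => ?_
  refine hg.eq_of_dvd_sub ?_
  rw [show p l - q i - (p l - q j) = -(q i - q j) by ring]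
  exact h.neg_right

theorem toeplitzMinor_eq_of_evenRearr_right (hg : Function.Periodic g (T : ℤ)) (p : Fin k → ℤ)
    {q q' : Fin k → ℤ} (h : EvenRearr T q q') : toeplitzMinor g p q = toeplitzMinor g p q' := by
  obtain ⟨σ, hσ, h⟩ := h
  rw [← toeplitzMinor_congr_right hg p (q := q ∘ σ) h, toeplitzMinor_perm_right, hσ]
  simp

theorem Function.Periodic.comp_neg_int (hg : Function.Periodic g (T : ℤ)) :
    Function.Periodic (fun t => g (-t)) (T : ℤ) := fun t => by
  change g (-(t + T)) = g (-t)
  exact hg.eq_of_dvd_sub ⟨-1, by ring⟩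

theorem toeplitzMinor_eq_of_evenRearr_left (hg : Function.Periodic g (T : ℤ)) (q : Fin k → ℤ)
    {p p' : Fin k → ℤ} (h : EvenRearr T p p') : toeplitzMinor g p q = toeplitzMinor g p' q := by
  rw [← toeplitzMinor_comm, ← toeplitzMinor_comm g p']
  exact toeplitzMinor_eq_of_evenRearr_right hg.comp_neg_int q h

theorem toeplitzMinor_add (g : ℤ → ℂ) (p q : Fin k → ℤ) (c : ℤ) :
    toeplitzMinor g (fun i => p i + c) q = toeplitzMinor g p (fun i => q i - c) := by
  unfold toeplitzMinor
  congr 1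
  ext i j
  simp only [Matrix.of_apply]
  congr 1
  ring

theorem CycMono.add_const {q : Fin k → ℤ} (hq : CycMono T q) (c : ℤ) :
    CycMono T (fun i => q i + c) where
  strictMono := fun i j h => by have := hq.strictMono h; simpa
  lt_add := fun i j => by have := hq.lt_add i j; linarith

theorem cycMono_coe (h : k ≤ T) : CycMono T (fun i : Fin k => ((i : ℕ) : ℤ)) where
  strictMono := fun i j h => by simpa using h
  lt_add := fun i j => by omega

theorem cycMono_orderEmb (e : Fin k ↪o Fin T) : CycMono T (fun i => ((e i : ℕ) : ℤ)) where
  strictMono := fun i j h => by have := e.strictMono h; simpa using this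
  lt_add := fun i j => by have := (e i).2; omega

theorem EvenRearr.refl (q : Fin k → ℤ) : EvenRearr T q q := ⟨1, by simp, by simp⟩

theorem EvenRearr.trans {q q' q'' : Fin k → ℤ} (h : EvenRearr T q q') (h' : EvenRearr T q' q'') :
    EvenRearr T q q'' := by
  obtain ⟨σ, hσ, h⟩ := h
  obtain ⟨τ, hτ, h'⟩ := h'
  refine ⟨σ * τ, by simp [hσ, hτ], fun i => ?_⟩
  have := dvd_add (h (τ i)) (h' i)
  simpa using this

theorem EvenRearr.add_mul (q : Fin k → ℤ) (c : ℤ) : EvenRearr T q (fun i => q i + c * T) :=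
  ⟨1, by simp, fun i => ⟨-c, by simp; ring⟩⟩

end Basic

/-! ### Rotating cyclic tuples into the window [0, T) -/

section Rotate

variable {T n : ℕ}

/-- The last entry of the tuple, lowered by `T`, is moved to the front. -/
def rotateTuple (T : ℕ) (q : Fin (n + 1) → ℤ) : Fin (n + 1) → ℤ :=
  Fin.cons (q (Fin.last n) - T) fun i => q i.castSucc

theorem CycMono.rotate {q : Fin (n + 1) → ℤ} (hq : CycMono T q) : CycMono T (rotateTuple T q) where
  strictMono := fun i j h => by
    induction i using Fin.cases with
    | zero =>
      induction j using Fin.cases with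
      | zero => exact absurd h (lt_irrefl _)
      | succ j =>
        have := hq.lt_add (Fin.last n) j.castSucc
        simp only [rotateTuple, Fin.cons_zero, Fin.cons_succ]
        linarith
    | succ i =>
      induction j using Fin.cases with
      | zero => exact absurd h (by simp)
      | succ j =>
        simp only [rotateTuple, Fin.cons_succ]
        exact hq.strictMono (Fin.castSucc_lt_castSucc_iff.mpr (Fin.succ_lt_succ_iff.mp h))
  lt_add := fun i j => by
    have hT : (0 : ℤ) < T := by have := hq.lt_add 0 0; linarith
    induction i using Fin.cases with
    | zero =>
      induction j using Fin.cases with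
      | zero => linarith
      | succ j =>
        have := hq.lt_add (Fin.last n) j.castSucc
        simp only [rotateTuple, Fin.cons_zero, Fin.cons_succ]
        linarith
    | succ i =>
      induction j using Fin.cases with
      | zero =>
        have := hq.strictMono (Fin.castSucc_lt_last i)
        simp only [rotateTuple, Fin.cons_zero, Fin.cons_succ]
        linarith
      | succ j =>
        simp only [rotateTuple, Fin.cons_succ]
        exact hq.lt_add _ _

/-- The cyclic shift of n + 1 points has sign (-1)^n; this is where odd order of the minors matters.
-/
theorem EvenRearr.rotate (hn : Even n) (q : Fin (n + 1) → ℤ) :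
    EvenRearr T q (rotateTuple T q) := by
  refine ⟨(finRotate (n + 1)).symm, by simp [sign_finRotate, hn.neg_one_pow], fun i => ?_⟩
  induction i using Fin.cases with
  | zero =>
    rw [show (finRotate (n + 1)).symm 0 = Fin.last n by
      rw [Equiv.symm_apply_eq, finRotate_last]]
    exact ⟨1, by simp [rotateTuple]⟩
  | succ i =>
    rw [show (finRotate (n + 1)).symm i.succ = i.castSucc by
      rw [Equiv.symm_apply_eq]; simp]
    simp [rotateTuple]

theorem sum_rotateTuple (q : Fin (n + 1) → ℤ) : ∑ i, rotateTuple T q i = ∑ i, q i - T := by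
  rw [Fin.sum_univ_succ, Fin.sum_univ_castSucc]
  simp [rotateTuple]
  ring

/-- Rotation is repeated until the last entry drops below T. Each rotation lowers the sum by T and
keeps the entries nonnegative, so the bound N on the sum serves as induction measure. -/
theorem CycMono.exists_orderEmb_of_nonneg (hn : Even n) (N : ℕ) {q : Fin (n + 1) → ℤ}
    (hq : CycMono T q) (h0 : 0 ≤ q 0) (hT : q 0 < T) (hN : ∑ i, q i ≤ N) :
    ∃ e : Fin (n + 1) ↪o Fin T, EvenRearr T q fun i => ((e i : ℕ) : ℤ) := by
  have hT0 : (0 : ℤ) < T := by have := hq.lt_add 0 0; linarith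
  induction N using Nat.strong_induction_on generalizing q with
  | _ N ih =>
    by_cases hl : q (Fin.last n) < T
    · have hlow : ∀ i, 0 ≤ q i := fun i => h0.trans (hq.strictMono.monotone (Fin.zero_le i))
      have hup : ∀ i, q i < T := fun i =>
        (hq.strictMono.monotone (Fin.le_last i)).trans_lt hl
      have hlt : ∀ i, (q i).toNat < T := fun i => by have := hlow i; have := hup i; omega
      refine ⟨OrderEmbedding.ofStrictMono (fun i => ⟨(q i).toNat, hlt i⟩) ?_, ?_⟩
      · intro i j h
        have := hq.strictMono h
        have := hlow i
        simp only [Fin.mk_lt_mk]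
        omega
      · refine ⟨1, by simp, fun i => ?_⟩
        have h1 : (((q i).toNat : ℕ) : ℤ) = q i := Int.toNat_of_nonneg (hlow i)
        change (T : ℤ) ∣ q i - (((q i).toNat : ℕ) : ℤ)
        simp [h1]
    -- This gives T ≤ ∑ q ≤ N, so the truncated `N - T` is a genuine difference, and it is smaller
    -- than N because T > 0.
    · have hsum : (0 : ℤ) ≤ ∑ i, rotateTuple T q i := Finset.sum_nonneg fun i _ => by
        induction i using Fin.cases with
        | zero => simp only [rotateTuple, Fin.cons_zero]; linarith
        | succ i =>
          simp only [rotateTuple, Fin.cons_succ]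
          exact h0.trans (hq.strictMono.monotone (Fin.zero_le _))
      have hs := sum_rotateTuple (T := T) q
      obtain ⟨e, he⟩ := ih (N - T) (by omega) hq.rotate
        (by simp only [rotateTuple, Fin.cons_zero]; linarith)
        (by
          have := hq.lt_add (Fin.last n) 0
          simp only [rotateTuple, Fin.cons_zero]; linarith) (by omega)
      exact ⟨e, (EvenRearr.rotate hn q).trans he⟩

theorem CycMono.exists_orderEmb (hn : Even n) {q : Fin (n + 1) → ℤ} (hq : CycMono T q) :
    ∃ e : Fin (n + 1) ↪o Fin T, EvenRearr T q fun i => ((e i : ℕ) : ℤ) := by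
  have hT0 : (0 : ℤ) < T := by have := hq.lt_add 0 0; linarith
  have key := Int.emod_add_mul_ediv (q 0) T
  obtain ⟨e, he⟩ := (hq.add_const (-(q 0 / T) * T)).exists_orderEmb_of_nonneg hn
    (∑ i, (q i + -(q 0 / T) * T)).toNat
    (by have := Int.emod_nonneg (q 0) hT0.ne'; linarith)
    (by have := Int.emod_lt_of_pos (q 0) hT0; linarith) (Int.self_le_toNat _)
  exact ⟨e, (EvenRearr.add_mul q _).trans he⟩

end Rotate

/-! ### Convolution with 1 + a z -/

section Step

variable {T k : ℕ} {g : ℤ → ℂ}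

/-- Convolution of `g` with `1 + a z`. -/
def bidiagStep (a : ℂ) (g : ℤ → ℂ) : ℤ → ℂ := fun t => g t + a * g (t - 1)

theorem Function.Periodic.bidiagStep (hg : Function.Periodic g (T : ℤ)) (a : ℂ) :
    Function.Periodic (bidiagStep a g) (T : ℤ) := fun t => by
  have h1 := hg t
  have h2 := hg (t - 1)
  simp only [_root_.bidiagStep, h1]
  rw [show t + (T : ℤ) - 1 = t - 1 + T by ring, h2]

/-- The tuple `q` with the entries at positions outside `s` raised by one. -/
def raise (q : Fin k → ℤ) (s : Finset (Fin k)) : Fin k → ℤ :=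
  fun i => if i ∈ s then q i else q i + 1

/-- Multilinearity in the columns: each column is the old one plus a times the column with index one
higher. -/
theorem toeplitzMinor_bidiagStep (a : ℂ) (g : ℤ → ℂ) (p q : Fin k → ℤ) :
    toeplitzMinor (bidiagStep a g) p q =
      ∑ s : Finset (Fin k), a ^ sᶜ.card * toeplitzMinor g p (raise q s) := by
  have h : ∀ (g : ℤ → ℂ) (q : Fin k → ℤ), toeplitzMinor g p q =
      Matrix.detRowAlternating.toMultilinearMap (fun j i => g (p i - q j)) := fun g q => by
    rw [toeplitzMinor, ← Matrix.det_transpose]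
    rfl
  rw [h, show (fun j i => bidiagStep a g (p i - q j)) =
    (fun j i => g (p i - q j)) + (fun j => a • fun i => g (p i - (q j + 1))) by
      ext j i
      simp [bidiagStep, sub_sub], MultilinearMap.map_add_univ]
  refine Finset.sum_congr rfl fun s _ => ?_
  rw [h, ← smul_eq_mul, ← Finset.prod_const, ← MultilinearMap.map_piecewise_smul]
  congr 1
  ext j i
  by_cases hj : j ∈ s <;> simp [hj, raise]

/-- Raising integers by at most one can only turn the strict inequalities of `CycMono` into
equalities. An equality makes two columns congruent modulo T, and the minor vanishes. -/
theorem raise_cycMono_or (hg : Function.Periodic g (T : ℤ)) (p : Fin k → ℤ) {q : Fin k → ℤ}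
    (hq : CycMono T q) (s : Finset (Fin k)) :
    CycMono T (raise q s) ∨ toeplitzMinor g p (raise q s) = 0 := by
  by_cases h : CycMono T (raise q s)
  · exact .inl h
  right
  by_contra h0
  apply h
  have hne : ∀ i j, i ≠ j → raise q s i ≠ raise q s j := fun i j hij he =>
    h0 (toeplitzMinor_eq_zero_of_dvd hg p hij (by simp [he]))
  have hneT : ∀ i j, raise q s i ≠ raise q s j + T := fun i j he => by
    have hij : i ≠ j := by
      rintro rfl
      have := hq.lt_add i i
      omega
    exact h0 (toeplitzMinor_eq_zero_of_dvd hg p hij (by simp [he]))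
  refine ⟨fun i j hij => lt_of_le_of_ne ?_ (hne i j hij.ne), fun i j =>
    lt_of_le_of_ne ?_ (hneT i j)⟩
  · have := hq.strictMono hij
    simp only [raise]
    split_ifs <;> omega
  · have := hq.lt_add i j
    simp only [raise]
    split_ifs <;> omega

theorem raise_univ (q : Fin k → ℤ) : raise q Finset.univ = q := by
  ext i
  simp [raise]

theorem toeplitzMinor_raise_nonneg (hg : Function.Periodic g (T : ℤ)) {p : Fin k → ℤ}
    (h : ∀ q, CycMono T q → 0 ≤ toeplitzMinor g p q) {q : Fin k → ℤ}
    (hq : CycMono T q) (s : Finset (Fin k)) : 0 ≤ toeplitzMinor g p (raise q s) := by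
  rcases raise_cycMono_or hg p hq s with h' | h'
  · exact h _ h'
  · exact h'.ge

/-- Convolution with `1 + a z` enlarges the minors in fixed rows, if they are nonnegative. -/
theorem le_toeplitzMinor_bidiagStep (hg : Function.Periodic g (T : ℤ)) {p : Fin k → ℤ}
    (h : ∀ q, CycMono T q → 0 ≤ toeplitzMinor g p q) {a : ℂ} (ha : 0 ≤ a) {q : Fin k → ℤ}
    (hq : CycMono T q) : toeplitzMinor g p q ≤ toeplitzMinor (bidiagStep a g) p q := by
  rw [toeplitzMinor_bidiagStep]
  have := Finset.single_le_sum (f := fun s : Finset (Fin k) =>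
    a ^ sᶜ.card * toeplitzMinor g p (raise q s))
    (fun s _ => mul_nonneg (pow_nonneg ha _) (toeplitzMinor_raise_nonneg hg h hq s))
    (Finset.mem_univ Finset.univ)
  simpa [raise_univ] using this

/-- The two expansions are compared term by term; at most k columns are raised, so each power of a
is at least a^k. -/
theorem toeplitzMinor_bidiagStep_le (hg : Function.Periodic g (T : ℤ)) {p : Fin k → ℤ}
    {g' : ℤ → ℂ} (hg' : Function.Periodic g' (T : ℤ)) {a c : ℂ} (ha : 0 ≤ a) (ha1 : a ≤ 1)
    (h0 : ∀ q, CycMono T q → 0 ≤ toeplitzMinor g p q) (hc : 0 ≤ c)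
    (h : ∀ q, CycMono T q → c * toeplitzMinor g p q ≤ toeplitzMinor g' p q) {q : Fin k → ℤ}
    (hq : CycMono T q) :
    a ^ k * c * toeplitzMinor (bidiagStep 1 g) p q ≤ toeplitzMinor (bidiagStep a g') p q := by
  rw [toeplitzMinor_bidiagStep, toeplitzMinor_bidiagStep, Finset.mul_sum]
  refine Finset.sum_le_sum fun s _ => ?_
  rw [one_pow, one_mul, mul_assoc]
  have h1 : c * toeplitzMinor g p (raise q s) ≤ toeplitzMinor g' p (raise q s) := by
    by_cases h' : CycMono T (raise q s)
    · exact h _ h'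
    · rw [(raise_cycMono_or hg p hq s).resolve_left h', (raise_cycMono_or hg' p hq s).resolve_left h']
      simp
  have h2 : 0 ≤ c * toeplitzMinor g p (raise q s) :=
    mul_nonneg hc (toeplitzMinor_raise_nonneg hg h0 hq s)
  have h3 : a ^ k ≤ a ^ sᶜ.card := by
    refine pow_le_pow_of_le_one ha ha1 ?_
    simpa using Finset.card_le_univ sᶜ
  exact mul_le_mul h3 h1 h2 (pow_nonneg ha _)

end Step

/-! ### The three-term Plücker relation -/

section Pluecker

/-- Cramer's rule writes det M • a as a combination of the rows of M. Inserted as row i of M with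
row j replaced by c, every row other than i and j occurs twice, so only two terms survive. -/
theorem Matrix.det_mul_det_updateRow_updateRow {ι R : Type*} [Fintype ι] [DecidableEq ι]
    [CommRing R] (M : Matrix ι ι R) {i j : ι} (hij : i ≠ j) (a c : ι → R) :
    M.det * ((M.updateRow i a).updateRow j c).det =
      (M.updateRow i a).det * (M.updateRow j c).det +
        (M.updateRow j a).det * ((M.updateRow i (M j)).updateRow j c).det := by
  have hcomm : ∀ x, (M.updateRow i x).updateRow j c = (M.updateRow j c).updateRow i x :=
    fun x => Function.update_comm hij _ _ _
  let L : (ι → R) →ₗ[R] R :=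
    (Matrix.detRowAlternating (R := R) (n := ι)).toMultilinearMap.toLinearMap (M.updateRow j c) i
  have hL : ∀ x, L x = ((M.updateRow j c).updateRow i x).det := fun x => rfl
  have hsum : M.det • a = ∑ l, (M.updateRow l a).det • M l := by
    have := Matrix.mulVec_cramer M.transpose a
    rw [Matrix.det_transpose] at this
    rw [← this]
    ext x
    simp [Matrix.mulVec, dotProduct, Matrix.cramer_transpose_apply, mul_comm]
  rw [hcomm, hcomm, ← hL, ← hL, ← smul_eq_mul, ← map_smul, hsum, map_sum]
  rw [← Finset.sum_subset (Finset.subset_univ {i, j}), Finset.sum_pair hij]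
  · simp only [map_smul, smul_eq_mul]
    congr 2
    rw [hL]
    congr 1
    ext x y
    by_cases hx : x = i
    · subst hx; simp [hij]
    · simp [hx, Matrix.updateRow_apply]
  · intro l _ hl
    simp only [Finset.mem_insert, Finset.mem_singleton, not_or] at hl
    have h0 : ((M.updateRow j c).updateRow i (M l)).det = 0 := by
      refine Matrix.det_zero_of_row_eq (Ne.symm hl.1) ?_
      ext y
      simp [Matrix.updateRow_apply, hl.1, hl.2]
    rw [map_smul, hL, h0, smul_eq_mul, mul_zero]

variable {k : ℕ}

theorem toeplitzMinor_mul_update (g : ℤ → ℂ) (p q : Fin k → ℤ) {i j : Fin k} (hij : i ≠ j)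
    (a c : ℤ) :
    toeplitzMinor g p q *
        toeplitzMinor g (Function.update (Function.update p i a) j c) q =
      toeplitzMinor g (Function.update p i a) q * toeplitzMinor g (Function.update p j c) q +
        toeplitzMinor g (Function.update p j a) q *
          toeplitzMinor g (Function.update (Function.update p i (p j)) j c) q := by
  have h : ∀ (p : Fin k → ℤ) (i : Fin k) (a : ℤ),
      (Matrix.of fun l m => g (Function.update p i a l - q m)) =
        (Matrix.of fun l m => g (p l - q m)).updateRow i fun m => g (a - q m) := by
    intro p i a
    ext l m
    by_cases hl : l = i
    · subst hl; simp
    · simp [hl, Matrix.updateRow_apply]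
  simp only [toeplitzMinor, h]
  exact Matrix.det_mul_det_updateRow_updateRow _ hij _ _

end Pluecker

/-! ### From nonnegative to positive minors -/

section Positivity

variable {T n : ℕ} {g : ℤ → ℂ}

/-- If a tuple starts with a run of `b` consecutive integers which can be neither prolonged
to the left nor to the right, then a three-term Plücker relation expresses its minor by minors
of tuples with a longer run, or with a run closer to the next entry. -/
theorem toeplitzMinor_pos_of_run_step {p q : Fin (n + 1) → ℤ} {b : ℕ} (hb : 1 ≤ b)
    (hbn : b < n + 1) (hnn : ∀ p, CycMono T p → 0 ≤ toeplitzMinor g p q) (hp : CycMono T p)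
    (hrun : ∀ i : Fin (n + 1), (i : ℕ) < b → p i = p 0 + (i : ℕ))
    (hgap : p 0 + b < p ⟨b, hbn⟩) (hlast : p (Fin.last n) < p 0 - 1 + T)
    (hlong : ∀ p, CycMono T p → (∀ i : Fin (n + 1), (i : ℕ) < b + 1 → p i = p 0 + (i : ℕ)) →
      0 < toeplitzMinor g p q)
    (hclose : ∀ p', CycMono T p' → (∀ i : Fin (n + 1), (i : ℕ) < b → p' i = p' 0 + (i : ℕ)) →
      p' 0 = p 0 + 1 → p' ⟨b, hbn⟩ = p ⟨b, hbn⟩ → 0 < toeplitzMinor g p' q) :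
    0 < toeplitzMinor g p q := by
  set B : Fin (n + 1) := ⟨b, hbn⟩ with hB
  have hup : ∀ i, p i < p 0 - 1 + T := fun i =>
    (hp.strictMono.monotone (Fin.le_last i)).trans_lt hlast
  have hBv : (B : ℕ) = b := rfl
  have hge : ∀ i : Fin (n + 1), b ≤ i → p B ≤ p i := fun i hi =>
    hp.strictMono.monotone (by simpa [Fin.le_def, hB] using hi)
  have hgt : ∀ i : Fin (n + 1), b < i → p B < p i := fun i hi =>
    hp.strictMono (by simpa [Fin.lt_def, hB] using hi)
  have hsm : ∀ i j : Fin (n + 1), (i : ℕ) < j → p i < p j := fun i j h => hp.strictMono h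
  have h0B : (0 : Fin (n + 1)) ≠ B := by
    simp only [hB, ne_eq, Fin.ext_iff, Fin.val_zero]; omega
  have hupB := hup B
  set a := p 0 - 1 with ha
  set c := p 0 + b with hc
  -- These are the sorted tuples of the Plücker relation that exchanges p 0 and p B for a and c. In
  -- s₁ the run absorbs a on the left and p B is dropped; in s₂ the run moves one step right,
  -- towards p B. In u₁ and u₂ one entry is replaced in place.
  let s₁ : Fin (n + 1) → ℤ := fun i => if (i : ℕ) ≤ b then a + (i : ℕ) else p i
  let s₂ : Fin (n + 1) → ℤ := fun i => if (i : ℕ) < b then p 0 + 1 + (i : ℕ) else p i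
  let u₁ : Fin (n + 1) → ℤ := fun i => if (i : ℕ) = 0 then a else p i
  let u₂ : Fin (n + 1) → ℤ := fun i => if (i : ℕ) = b then c else p i
  have hs₁ : CycMono T s₁ := by
    refine ⟨fun i j hij => ?_, fun i j => ?_⟩
    · have := hge j; have := hgt j; have := hsm i j hij
      have : (i : ℕ) < j := hij
      simp only [s₁]
      split_ifs <;> omega
    · have := hge j; have := hgt j; have := hup i; have := hp.lt_add i j
      have := hgt i; have := hrun i
      simp only [s₁]
      split_ifs <;> omega
  have hs₂ : CycMono T s₂ := by
    refine ⟨fun i j hij => ?_, fun i j => ?_⟩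
    · have := hge j; have := hgt j; have := hsm i j hij
      have : (i : ℕ) < j := hij
      simp only [s₂]
      split_ifs <;> omega
    · have := hge j; have := hgt j; have := hup i; have := hp.lt_add i j
      have := hgt i; have := hrun i
      simp only [s₂]
      split_ifs <;> omega
  have hu₁ : CycMono T u₁ := by
    refine ⟨fun i j hij => ?_, fun i j => ?_⟩
    · have := hsm 0 j; have := hsm i j hij
      have : (i : ℕ) < j := hij
      simp only [Fin.val_zero] at *
      simp only [u₁]
      split_ifs <;> omega
    · have := hup i; have := hp.lt_add i j; have := hsm 0 j
      simp only [Fin.val_zero] at *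
      simp only [u₁]
      split_ifs <;> omega
  have hu₂ : CycMono T u₂ := by
    refine ⟨fun i j hij => ?_, fun i j => ?_⟩
    · have := hge j; have := hgt j; have := hsm i j hij; have := hrun i
      have : (i : ℕ) < j := hij
      simp only [u₂]
      split_ifs <;> omega
    · have := hge j; have := hgt j; have := hup i; have := hp.lt_add i j
      have := hgt i; have := hrun i; have := hrun j; have := hge i
      simp only [u₂]
      split_ifs <;> omega
  have e₁ : Function.update p 0 a = u₁ := by
    ext i
    have : i = 0 ↔ (i : ℕ) = 0 := Fin.ext_iff
    simp only [Function.update_apply, u₁, this]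
  have e₂ : Function.update p B c = u₂ := by
    ext i
    have : i = B ↔ (i : ℕ) = b := Fin.ext_iff
    simp only [Function.update_apply, u₂, this]
  -- Sorting costs the same cycle in both factors of the last product, so the signs cancel.
  have f₁ : Function.update p B a = s₁ ∘ B.cycleRange := by
    ext i
    have := hrun i
    rcases lt_trichotomy i B with h | h | h
    · have h' : (i : ℕ) < b := h
      simp only [Function.comp, s₁, Fin.coe_cycleRange_of_lt h, Function.update_of_ne h.ne]
      split_ifs <;> push_cast <;> omega
    · subst h
      simp [s₁]
    · have h' : b < (i : ℕ) := h
      simp only [Function.comp, s₁, Fin.cycleRange_of_gt h, Function.update_of_ne h.ne']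
      split_ifs <;> omega
  have f₂ : s₂ = Function.update (Function.update p 0 (p B)) B c ∘ B.cycleRange := by
    ext i
    rcases lt_trichotomy i B with h | h | h
    · have h' : (i : ℕ) < b := h
      have hv := Fin.coe_cycleRange_of_lt h
      have := hrun (B.cycleRange i)
      have h3 : B.cycleRange i ≠ 0 := by
        intro h0; rw [h0] at hv; simp at hv
      have h4 : (B.cycleRange i = B) ↔ (i : ℕ) + 1 = b := by
        rw [Fin.ext_iff, hv]
      simp only [Function.comp, s₂, Function.update_apply, h3, h4, if_false]
      split_ifs <;> omega
    · rw [h]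
      simp [s₂, Function.update_of_ne h0B, hBv]
    · have h' : b < (i : ℕ) := h
      have h3 : i ≠ 0 := by intro h0; rw [h0] at h'; simp at h'
      simp only [Function.comp, s₂, Fin.cycleRange_of_gt h, Function.update_of_ne h.ne',
        Function.update_of_ne h3]
      split_ifs <;> omega
  have key := toeplitzMinor_mul_update g p q h0B a c
  have h1 : 0 ≤ toeplitzMinor g u₁ q * toeplitzMinor g u₂ q := mul_nonneg (hnn _ hu₁) (hnn _ hu₂)
  have h2 : 0 < toeplitzMinor g s₁ q * toeplitzMinor g s₂ q := by
    refine mul_pos (hlong _ hs₁ fun i hi => ?_) (hclose _ hs₂ (fun i hi => ?_) ?_ ?_)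
    · simp only [s₁, Fin.val_zero]
      split_ifs <;> omega
    · simp only [s₂, Fin.val_zero]
      split_ifs <;> omega
    · simp only [s₂, Fin.val_zero]
      split_ifs <;> omega
    · simp [s₂, hB]
  have h3 : toeplitzMinor g (Function.update p B a) q *
      toeplitzMinor g (Function.update (Function.update p 0 (p B)) B c) q =
      toeplitzMinor g s₁ q * toeplitzMinor g s₂ q := by
    rw [f₁, f₂, toeplitzMinor_perm_left, toeplitzMinor_perm_left]
    ring
  rw [e₁, e₂, h3] at key
  refine lt_of_le_of_ne (hnn p hp) fun h0 => ?_
  rw [← h0, zero_mul] at key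
  exact absurd key (add_pos_of_nonneg_of_pos h1 h2).ne

/-- Outer induction on the number d of entries outside the run, inner induction on a bound N for the
gap after the run. A closed gap lengthens the run. -/
theorem toeplitzMinor_pos_of_run (hn : Even n) (hg : Function.Periodic g (T : ℤ))
    {q : Fin (n + 1) → ℤ} (hnn : ∀ p, CycMono T p → 0 ≤ toeplitzMinor g p q)
    (hpos : ∀ c : ℤ, 0 < toeplitzMinor g (fun i => ((i : ℕ) : ℤ) + c) q) (d : ℕ) :
    ∀ b, 1 ≤ b → b + d = n + 1 → ∀ p, CycMono T p →
      (∀ i : Fin (n + 1), (i : ℕ) < b → p i = p 0 + (i : ℕ)) → 0 < toeplitzMinor g p q := by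
  induction d with
  | zero =>
    intro b _ hb p _ hrun
    convert hpos (p 0) using 2
    ext i
    rw [hrun i (by omega), add_comm]
  | succ d ih =>
    intro b hb hbd
    have hbn : b < n + 1 := by omega
    have hlong := ih (b + 1) (by omega) (by omega)
    suffices h : ∀ (N : ℕ) (p : Fin (n + 1) → ℤ), CycMono T p →
        (∀ i : Fin (n + 1), (i : ℕ) < b → p i = p 0 + (i : ℕ)) → p ⟨b, hbn⟩ ≤ p 0 + b + N →
        0 < toeplitzMinor g p q from fun p hp hrun =>
      h (p ⟨b, hbn⟩ - p 0 - b).toNat p hp hrun (by omega)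
    intro N
    induction N with
    | zero =>
      intro p hp hrun hN
      refine hlong p hp fun i hi => ?_
      rcases Nat.lt_succ_iff_lt_or_eq.mp hi with hi | hi
      · exact hrun i hi
      · obtain rfl : i = ⟨b, hbn⟩ := Fin.ext hi
        have h1 := hrun ⟨b - 1, by omega⟩ (by simp; omega)
        have h2 : p ⟨b - 1, by omega⟩ < p ⟨b, hbn⟩ := hp.strictMono (by simp [Fin.lt_def]; omega)
        simp only at *
        omega
    | succ N ihN =>
      intro p hp hrun hN
      by_cases hgap : p 0 + b < p ⟨b, hbn⟩
      swap
      · exact ihN p hp hrun (by omega)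
      by_cases hlast : p (Fin.last n) < p 0 - 1 + T
      · refine toeplitzMinor_pos_of_run_step hb hbn hnn hp hrun hgap hlast hlong ?_
        intro p' hp' hrun' h0 hB
        exact ihN p' hp' hrun' (by omega)
      -- Here the last entry is p 0 - 1 + T; rotation places it directly before the run.
      · have hl := hp.lt_add (Fin.last n) 0
        rw [toeplitzMinor_eq_of_evenRearr_left hg q (EvenRearr.rotate hn p)]
        refine hlong _ hp.rotate fun i hi => ?_
        induction i using Fin.cases with
        | zero => simp
        | succ i =>
          have := hrun i.castSucc (by simp at hi ⊢; omega)
          simp only [rotateTuple, Fin.cons_succ, Fin.cons_zero, this]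
          simp
          omega

/-- If the minors of all increasing row tuples are nonnegative, and positive for consecutive rows,
then they are all positive. -/
theorem toeplitzMinor_pos_of_nonneg (hn : Even n) (hg : Function.Periodic g (T : ℤ))
    {q : Fin (n + 1) → ℤ} (hnn : ∀ p, CycMono T p → 0 ≤ toeplitzMinor g p q)
    (hpos : ∀ c : ℤ, 0 < toeplitzMinor g (fun i => ((i : ℕ) : ℤ) + c) q)
    {p : Fin (n + 1) → ℤ} (hp : CycMono T p) : 0 < toeplitzMinor g p q :=
  toeplitzMinor_pos_of_run hn hg hnn hpos n 1 le_rfl (by omega) p hp fun i hi => by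
    obtain rfl : i = 0 := Fin.ext (by simpa using hi)
    simp

end Positivity

/-! ### Removing a factor 1 + z by continuity -/

section Descent

variable {T n : ℕ} {g : ℤ → ℂ}

theorem im_toeplitzMinor_bidiagStep {k : ℕ} (hreal : ∀ p q : Fin k → ℤ, (toeplitzMinor g p q).im = 0)
    (a : ℝ) (p q : Fin k → ℤ) : (toeplitzMinor (bidiagStep a g) p q).im = 0 := by
  rw [toeplitzMinor_bidiagStep, Complex.im_sum]
  refine Finset.sum_eq_zero fun s _ => ?_
  rw [← Complex.ofReal_pow, Complex.im_ofReal_mul, hreal, mul_zero]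

theorem continuous_toeplitzMinor {X : Type*} [TopologicalSpace X] {k : ℕ} {f : X → ℤ → ℂ}
    (hf : ∀ t, Continuous fun x => f x t) (p q : Fin k → ℤ) :
    Continuous fun x => toeplitzMinor (f x) p q :=
  Continuous.matrix_det (continuous_matrix fun _ _ => hf _)

theorem bidiagStep_zero (g : ℤ → ℂ) : bidiagStep 0 g = g := by
  ext t
  simp [bidiagStep]

/-- Suppose that the minors of `g` with consecutive rows are positive. If all minors are positive
after convolution with `1 + z`, then they were so before. -/
theorem toeplitzMinor_pos_of_bidiagStep (hn : Even n) (hg : Function.Periodic g (T : ℤ))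
    (hreal : ∀ p q : Fin (n + 1) → ℤ, (toeplitzMinor g p q).im = 0)
    (hint : ∀ q : Fin (n + 1) → ℤ, CycMono T q →
      0 < toeplitzMinor g (fun i => ((i : ℕ) : ℤ)) q)
    (hstep : ∀ p q : Fin (n + 1) → ℤ, CycMono T p → CycMono T q →
      0 < toeplitzMinor (bidiagStep 1 g) p q)
    {p q : Fin (n + 1) → ℤ} (hp : CycMono T p) (hq : CycMono T q) :
    0 < toeplitzMinor g p q := by
  let φ : (Fin (n + 1) ↪o Fin T) → ℝ → ℝ := fun e a =>
    (toeplitzMinor (bidiagStep a g) (fun i => ((e i : ℕ) : ℤ)) q).re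
  have hφ : ∀ e, Continuous (φ e) := fun e =>
    Complex.continuous_re.comp (continuous_toeplitzMinor (fun t => by
      unfold bidiagStep
      fun_prop) _ _)
  have hre : ∀ (a : ℝ) (e : Fin (n + 1) ↪o Fin T),
      toeplitzMinor (bidiagStep a g) (fun i => ((e i : ℕ) : ℤ)) q = (φ e a : ℂ) := fun a e =>
    Complex.ext (by simp [φ]) (by simp [im_toeplitzMinor_bidiagStep hreal])
  -- Translating consecutive rows amounts to translating the columns the other way, which preserves
  -- `CycMono`.
  have hint' : ∀ a : ℝ, 0 ≤ a → ∀ c : ℤ,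
      0 < toeplitzMinor (bidiagStep a g) (fun i : Fin (n + 1) => ((i : ℕ) : ℤ) + c) q := by
    intro a ha c
    rw [toeplitzMinor_add]
    have hq' : CycMono T fun i => q i - c := by simpa [sub_eq_add_neg] using hq.add_const (-c)
    exact (hint _ hq').trans_le (le_toeplitzMinor_bidiagStep hg (fun q hq => (hint q hq).le)
      (by exact_mod_cast ha) hq')
  have hall : ∀ a : ℝ, 0 ≤ a → (∀ e, 0 ≤ φ e a) → ∀ p, CycMono T p →
      0 < toeplitzMinor (bidiagStep a g) p q := by
    intro a ha h p hp
    refine toeplitzMinor_pos_of_nonneg hn (hg.bidiagStep a) (fun p hp => ?_) (hint' a ha) hp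
    obtain ⟨e, he⟩ := hp.exists_orderEmb hn
    rw [toeplitzMinor_eq_of_evenRearr_left (hg.bidiagStep a) q he, hre]
    exact_mod_cast h e
  let bad : Set ℝ := ⋃ e, {a | a ∈ Set.Icc 0 1 ∧ φ e a ≤ 0}
  suffices hbad : bad = ∅ by
    have h0 : ∀ e, 0 ≤ φ e 0 := fun e => by
      by_contra h
      have : (0 : ℝ) ∈ bad := Set.mem_iUnion.mpr ⟨e, by simp, (not_le.mp h).le⟩
      rw [hbad] at this
      exact this
    have := hall 0 le_rfl h0 p hp
    rwa [Complex.ofReal_zero, bidiagStep_zero] at this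
  by_contra hne
  have hclosed : IsCompact bad := by
    have : Finite (Fin (n + 1) ↪o Fin T) := DFunLike.finite _
    refine isCompact_iUnion fun e => ?_
    exact isCompact_Icc.inter_right (isClosed_le (hφ e) continuous_const)
  -- The largest bad parameter a is below 1 by `hstep`. To its right the minors are positive, so at
  -- a they are nonnegative in the limit; `hall` then makes them positive, a contradiction.
  obtain ⟨a, ha, hmax⟩ := hclosed.exists_isGreatest (Set.nonempty_iff_ne_empty.mpr hne)
  obtain ⟨e, ⟨ha0, ha1⟩, hea⟩ := Set.mem_iUnion.mp ha
  have hane : a ≠ 1 := by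
    rintro rfl
    have := hstep _ q (cycMono_orderEmb e) hq
    rw [← Complex.ofReal_one, hre] at this
    exact absurd (by exact_mod_cast this) hea.not_gt
  have halt : a < 1 := lt_of_le_of_ne ha1 hane
  have hnn : ∀ e, 0 ≤ φ e a := fun e => by
    refine ge_of_tendsto ((hφ e).continuousWithinAt (s := Set.Ioi a) (x := a)) ?_
    filter_upwards [Ioo_mem_nhdsGT halt] with b hb
    by_contra h
    have : b ∈ bad := Set.mem_iUnion.mpr
      ⟨e, ⟨ha0.trans hb.1.le, hb.2.le⟩, (not_le.mp h).le⟩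
    exact absurd (hmax this) hb.1.not_ge
  have := hall a ha0 hnn _ (cycMono_orderEmb e)
  rw [hre] at this
  exact absurd (by exact_mod_cast this) hea.not_gt

end Descent

/-! ### Fourier expansion of minors -/

section Fourier

variable {T k : ℕ}

/-- The root of unity `exp (2πi / T)` raised to the power `(s - m) t`. -/
noncomputable def unityChar (T : ℕ) (m s t : ℤ) : ℂ :=
  Complex.exp (2 * Real.pi * Complex.I / T) ^ ((s - m) * t)

theorem unityChar_add (m s t t' : ℤ) :
    unityChar T m s (t + t') = unityChar T m s t * unityChar T m s t' := by
  rw [unityChar, mul_add, zpow_add₀ (Complex.exp_ne_zero _)]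
  rfl

theorem unityChar_sub (m s t t' : ℤ) :
    unityChar T m s (t - t') = unityChar T m s t * unityChar T m s (-t') := by
  rw [sub_eq_add_neg, unityChar_add]

theorem sum_exp_zpow (hT : T ≠ 0) (a : ℤ) :
    ∑ j : Fin T, Complex.exp (2 * Real.pi * Complex.I / T) ^ (a * (j : ℕ)) =
      if (T : ℤ) ∣ a then (T : ℂ) else 0 := by
  have hprim := Complex.isPrimitiveRoot_exp T hT
  have h : ∀ j : Fin T, Complex.exp (2 * Real.pi * Complex.I / T) ^ (a * (j : ℕ)) =
      (Complex.exp (2 * Real.pi * Complex.I / T) ^ a) ^ (j : ℕ) := fun j => by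
    rw [zpow_mul, zpow_natCast]
  simp only [h]
  rw [Fin.sum_univ_eq_sum_range fun j => (Complex.exp (2 * Real.pi * Complex.I / T) ^ a) ^ j]
  split_ifs with hd
  · rw [(hprim.zpow_eq_one_iff_dvd a).mpr hd]
    simp
  · have h1 : Complex.exp (2 * Real.pi * Complex.I / T) ^ a ≠ 1 := fun h =>
      hd ((hprim.zpow_eq_one_iff_dvd a).mp h)
    rw [geom_sum_eq h1, ← zpow_natCast, ← zpow_mul, mul_comm a, zpow_mul, zpow_natCast,
      hprim.pow_eq_one]
    simp

theorem Fin.dvd_coe_sub_coe_iff (s s' : Fin T) : (T : ℤ) ∣ ((s : ℕ) : ℤ) - ((s' : ℕ) : ℤ) ↔ s = s' := by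
  constructor
  · intro h
    have := Int.eq_zero_of_abs_lt_dvd h (by rw [abs_lt]; have := s.2; have := s'.2; omega)
    ext
    omega
  · rintro rfl
    simp

theorem exists_eq_sum_unityChar (hT : T ≠ 0) (m : ℤ) {g : ℤ → ℂ}
    (hg : Function.Periodic g (T : ℤ)) :
    ∃ c : Fin T → ℂ, ∀ t, g t = ∑ s : Fin T, c s * unityChar T m (s : ℕ) t := by
  have hTC : (T : ℂ) ≠ 0 := by exact_mod_cast hT
  refine ⟨fun s => (T : ℂ)⁻¹ * ∑ j : Fin T, g (j : ℕ) * unityChar T m (s : ℕ) (-(j : ℕ)), fun t => ?_⟩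
  have hcol : ∀ j : Fin T, ∑ s : Fin T, unityChar T m (s : ℕ) (t - (j : ℕ)) =
      if (T : ℤ) ∣ t - (j : ℕ) then (T : ℂ) else 0 := by
    intro j
    have : ∀ s : Fin T, unityChar T m (s : ℕ) (t - (j : ℕ)) =
        Complex.exp (2 * Real.pi * Complex.I / T) ^ (-m * (t - (j : ℕ))) *
          Complex.exp (2 * Real.pi * Complex.I / T) ^ ((t - (j : ℕ)) * (s : ℕ)) := fun s => by
      rw [← zpow_add₀ (Complex.exp_ne_zero _), unityChar]
      congr 1
      ring
    simp only [this]
    rw [← Finset.mul_sum, sum_exp_zpow hT]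
    split_ifs with hd
    · rw [((Complex.isPrimitiveRoot_exp T hT).zpow_eq_one_iff_dvd _).mpr (hd.mul_left _), one_mul]
    · rw [mul_zero]
  have hTpos : (0 : ℤ) < T := by positivity
  let j₀ : Fin T := ⟨(t % T).toNat, by
    have := Int.emod_lt_of_pos t hTpos
    have := Int.emod_nonneg t hTpos.ne'
    omega⟩
  have hj₀ : ((j₀ : ℕ) : ℤ) = t % T := Int.toNat_of_nonneg (Int.emod_nonneg t hTpos.ne')
  have hdvd : (T : ℤ) ∣ t - (j₀ : ℕ) := by
    rw [hj₀]
    exact Int.dvd_self_sub_emod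
  have hiff : ∀ j : Fin T, (T : ℤ) ∣ t - (j : ℕ) ↔ j = j₀ := fun j => by
    rw [← Fin.dvd_coe_sub_coe_iff, ← dvd_sub_right hdvd]
    rw [show t - ((j₀ : ℕ) : ℤ) - (t - (j : ℕ)) = (j : ℕ) - (j₀ : ℕ) by ring]
  calc g t = g (j₀ : ℕ) := hg.eq_of_dvd_sub hdvd
    _ = (T : ℂ)⁻¹ * ∑ j : Fin T, g (j : ℕ) * ∑ s : Fin T, unityChar T m (s : ℕ) (t - (j : ℕ)) := by
        simp only [hcol, hiff]
        simp [mul_comm, hTC]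
    _ = _ := by
        simp only [Finset.mul_sum, Finset.sum_mul]
        rw [Finset.sum_comm]
        refine Finset.sum_congr rfl fun s _ => Finset.sum_congr rfl fun j _ => ?_
        rw [unityChar_sub]
        ring

theorem sum_mul_unityChar (hT : T ≠ 0) (m : ℤ) {g : ℤ → ℂ} {c : Fin T → ℂ}
    (hc : ∀ t, g t = ∑ s : Fin T, c s * unityChar T m (s : ℕ) t) (s : Fin T) (p : ℤ) :
    ∑ j : Fin T, unityChar T m (s : ℕ) (j : ℕ) * g (p - (j : ℕ)) =
      T * c s * unityChar T m (s : ℕ) p := by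
  have horth : ∀ s' : Fin T, ∑ j : Fin T, unityChar T m (s : ℕ) (j : ℕ) *
      unityChar T m (s' : ℕ) (-((j : ℕ) : ℤ)) = if s = s' then (T : ℂ) else 0 := fun s' => by
    rw [← if_congr (Fin.dvd_coe_sub_coe_iff s s') rfl rfl, ← sum_exp_zpow hT]
    refine Finset.sum_congr rfl fun j _ => ?_
    rw [unityChar, unityChar, ← zpow_add₀ (Complex.exp_ne_zero _)]
    congr 1
    ring
  simp only [hc, Finset.mul_sum]
  rw [Finset.sum_comm]
  calc _ = ∑ s' : Fin T, c s' * unityChar T m (s' : ℕ) p * ∑ j : Fin T,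
        unityChar T m (s : ℕ) (j : ℕ) * unityChar T m (s' : ℕ) (-((j : ℕ) : ℤ)) := by
        refine Finset.sum_congr rfl fun s' _ => ?_
        rw [Finset.mul_sum]
        refine Finset.sum_congr rfl fun j _ => ?_
        rw [unityChar_sub]
        ring
    _ = _ := by
        simp only [horth]
        simp
        ring

/-- Column multilinearity: the Cauchy–Binet expansion before grouping the maps ψ by image. -/
theorem Matrix.det_of_sum_mul {R X ι : Type*} [CommRing R] [Fintype X] [Fintype ι] [DecidableEq ι]
    (a : ι → X → R) (b : X → ι → R) :
    (Matrix.of fun i l => ∑ x, a l x * b x i).det =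
      ∑ ψ : ι → X, (∏ l, a l (ψ l)) * (Matrix.of fun i l => b (ψ l) i).det := by
  have h : ∀ M : Matrix ι ι R, M.det =
      (Matrix.detRowAlternating (R := R) (n := ι)).toMultilinearMap fun l i => M i l := fun M => by
    rw [← Matrix.det_transpose]
    rfl
  rw [h, show (fun l i => (Matrix.of fun i l => ∑ x, a l x * b x i) i l) =
    fun l => ∑ x, a l x • b x by ext l i; simp, MultilinearMap.map_sum]
  refine Finset.sum_congr rfl fun ψ _ => ?_
  rw [MultilinearMap.map_smul_univ, smul_eq_mul, h]
  rfl

theorem toeplitzMinor_eq_sum {m : ℤ} {g : ℤ → ℂ} {c : Fin T → ℂ}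
    (hc : ∀ t, g t = ∑ s : Fin T, c s * unityChar T m (s : ℕ) t) (p q : Fin k → ℤ) :
    toeplitzMinor g p q = ∑ φ : Fin k → Fin T,
      (∏ l, c (φ l) * unityChar T m (φ l : ℕ) (-q l)) *
        (Matrix.of fun i l => unityChar T m (φ l : ℕ) (p i)).det := by
  rw [← Matrix.det_of_sum_mul (fun l s => c s * unityChar T m (s : ℕ) (-q l))
    (fun s i => unityChar T m (s : ℕ) (p i)), toeplitzMinor]
  congr 1
  ext i j
  simp only [Matrix.of_apply, hc]
  refine Finset.sum_congr rfl fun s _ => ?_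
  rw [unityChar_sub]
  ring

/-- The inverse transform, taken column by column. It recovers products of Fourier coefficients from
the minors in one fixed row tuple, whenever the character determinant is nonzero. -/
theorem prod_mul_det_unityChar (hT : T ≠ 0) {m : ℤ} {g : ℤ → ℂ} {c : Fin T → ℂ}
    (hc : ∀ t, g t = ∑ s : Fin T, c s * unityChar T m (s : ℕ) t) (p : Fin k → ℤ)
    (φ : Fin k → Fin T) :
    (∏ l, T * c (φ l)) * (Matrix.of fun i l => unityChar T m (φ l : ℕ) (p i)).det =
      ∑ ψ : Fin k → Fin T, (∏ l, unityChar T m (φ l : ℕ) (ψ l : ℕ)) *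
        toeplitzMinor g p fun l => ((ψ l : ℕ) : ℤ) := by
  unfold toeplitzMinor
  rw [← Matrix.det_of_sum_mul (fun l (s : Fin T) => unityChar T m (φ l : ℕ) (s : ℕ))
    (fun (s : Fin T) i => g (p i - (s : ℕ))), ← Matrix.det_mul_row]
  congr 1
  ext i j
  simp only [Matrix.of_apply, sum_mul_unityChar hT m hc]

theorem exists_perm_cycMono {ψ : Fin k → Fin T} (hψ : Function.Injective ψ) :
    ∃ σ : Equiv.Perm (Fin k), CycMono T ((fun l => ((ψ l : ℕ) : ℤ)) ∘ σ) := by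
  have hs : StrictMono (ψ ∘ Tuple.sort ψ) :=
    (Tuple.monotone_sort ψ).strictMono_of_injective (hψ.comp (Equiv.injective _))
  exact ⟨Tuple.sort ψ, cycMono_orderEmb (OrderEmbedding.ofStrictMono _ hs)⟩

theorem toeplitzMinor_congr_of_cycMono {g h : ℤ → ℂ} {p : Fin k → ℤ}
    (hgh : ∀ q, CycMono T q → toeplitzMinor g p q = toeplitzMinor h p q) (ψ : Fin k → Fin T) :
    toeplitzMinor g p (fun l => ((ψ l : ℕ) : ℤ)) = toeplitzMinor h p fun l => ((ψ l : ℕ) : ℤ) := by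
  by_cases hψ : Function.Injective ψ
  · obtain ⟨σ, hσ⟩ := exists_perm_cycMono hψ
    have := hgh _ hσ
    rw [toeplitzMinor_perm_right, toeplitzMinor_perm_right] at this
    exact mul_left_cancel₀ (by
      rcases Int.units_eq_one_or (Equiv.Perm.sign σ) with h | h <;> simp [h]) this
  · obtain ⟨i, j, hij, hne⟩ := Function.not_injective_iff.mp hψ
    have hz : ∀ g : ℤ → ℂ, toeplitzMinor g p (fun l => ((ψ l : ℕ) : ℤ)) = 0 := fun g =>
      Matrix.det_zero_of_column_eq hne fun l => by simp [hij]
    rw [hz, hz]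

theorem det_unityChar_ne_zero (hT : T ≠ 0) (m : ℤ) {φ : Fin k → Fin T}
    (hφ : Function.Injective φ) :
    (Matrix.of fun i l : Fin k => unityChar T m (φ l : ℕ) ((i : ℕ) : ℤ)).det ≠ 0 := by
  have : (Matrix.of fun i l : Fin k => unityChar T m (φ l : ℕ) ((i : ℕ) : ℤ)) =
      (Matrix.vandermonde fun l => unityChar T m (φ l : ℕ) 1).transpose := by
    ext i l
    simp [Matrix.vandermonde_apply, unityChar, zpow_mul]
  rw [this, Matrix.det_transpose, Matrix.det_vandermonde_ne_zero_iff]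
  intro l l' h
  apply hφ
  rw [← Fin.dvd_coe_sub_coe_iff, ← (Complex.isPrimitiveRoot_exp T hT).zpow_eq_one_iff_dvd]
  simp only [unityChar, mul_one] at h
  rw [show ((φ l : ℕ) : ℤ) - (φ l' : ℕ) = ((φ l : ℕ) - m) - ((φ l' : ℕ) - m) by ring,
    zpow_sub₀ (Complex.exp_ne_zero _), h, div_self (zpow_ne_zero _ (Complex.exp_ne_zero _))]

/-- The minors of a periodic sequence are determined by those with consecutive rows. -/
theorem toeplitzMinor_eq_of_consecutive_rows {g h : ℤ → ℂ} (hg : Function.Periodic g (T : ℤ))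
    (hh : Function.Periodic h (T : ℤ)) (hT : T ≠ 0)
    (hgh : ∀ q : Fin k → ℤ, CycMono T q → toeplitzMinor g (fun i => ((i : ℕ) : ℤ)) q =
      toeplitzMinor h (fun i => ((i : ℕ) : ℤ)) q) (p q : Fin k → ℤ) :
    toeplitzMinor g p q = toeplitzMinor h p q := by
  obtain ⟨c, hc⟩ := exists_eq_sum_unityChar hT 0 hg
  obtain ⟨d, hd⟩ := exists_eq_sum_unityChar hT 0 hh
  rw [toeplitzMinor_eq_sum hc, toeplitzMinor_eq_sum hd]
  refine Finset.sum_congr rfl fun φ _ => ?_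
  by_cases hφ : Function.Injective φ
  · have h1 := prod_mul_det_unityChar hT hc (fun i => ((i : ℕ) : ℤ)) φ
    have h2 := prod_mul_det_unityChar hT hd (fun i => ((i : ℕ) : ℤ)) φ
    simp only [toeplitzMinor_congr_of_cycMono hgh] at h1
    -- For consecutive rows the character determinant is a Vandermonde determinant in distinct roots
    -- of unity and can be cancelled.
    have h3 := mul_right_cancel₀ (det_unityChar_ne_zero hT 0 hφ) (h1.trans h2.symm)
    have hTC : (∏ _l : Fin k, (T : ℂ)) ≠ 0 :=
      Finset.prod_ne_zero_iff.mpr fun _ _ => by exact_mod_cast hT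
    rw [Finset.prod_mul_distrib, Finset.prod_mul_distrib] at h3
    rw [Finset.prod_mul_distrib, Finset.prod_mul_distrib, mul_left_cancel₀ hTC h3]
  · obtain ⟨i, j, hij, hne⟩ := Function.not_injective_iff.mp hφ
    have hz : (Matrix.of fun i l => unityChar T 0 (φ l : ℕ) (p i)).det = 0 :=
      Matrix.det_zero_of_column_eq hne fun l => by simp [hij]
    rw [hz, mul_zero, mul_zero]

/-- The conjugate sequence has the same consecutive-row minors, hence the same minors altogether. -/
theorem im_toeplitzMinor_eq_zero {g : ℤ → ℂ} (hg : Function.Periodic g (T : ℤ)) (hT : T ≠ 0)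
    (h : ∀ q : Fin k → ℤ, CycMono T q → 0 ≤ toeplitzMinor g (fun i => ((i : ℕ) : ℤ)) q)
    (p q : Fin k → ℤ) : (toeplitzMinor g p q).im = 0 := by
  have hconj : ∀ p q : Fin k → ℤ, toeplitzMinor (fun t => (starRingEnd ℂ) (g t)) p q =
      (starRingEnd ℂ) (toeplitzMinor g p q) := fun p q => by
    rw [toeplitzMinor, toeplitzMinor, RingHom.map_det]
    rfl
  rw [← Complex.conj_eq_iff_im, ← hconj]
  refine toeplitzMinor_eq_of_consecutive_rows (T := T) (fun t => by simp only [hg t]) hg hT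
    (fun q hq => ?_) p q
  rw [hconj, Complex.conj_eq_iff_im]
  exact (Complex.nonneg_iff.mp (h q hq)).2.symm

end Fourier

/-! ### Positivity of the product of low Fourier coefficients -/

section LowFrequencies

variable {T k m : ℕ}

theorem Fin.prod_prod_Ioi_mul {R : Type*} [CommMonoid R] (x : Fin k → R) :
    ∏ i, ∏ j ∈ Finset.Ioi i, x i * x j = ∏ i, x i ^ (k - 1) := by
  have h : ∏ i, ∏ j ∈ Finset.Ioi i, x j = ∏ j, ∏ i ∈ Finset.Iio j, x j :=
    Finset.prod_comm' (by simp)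
  simp only [Finset.prod_mul_distrib, h, Finset.prod_const, Fin.card_Ioi, Fin.card_Iio]
  rw [← Finset.prod_mul_distrib]
  refine Finset.prod_congr rfl fun i _ => ?_
  rw [← pow_add]
  congr 1
  omega

/-- The product of the chords between the points `exp (2πi q_j / T)`. -/
noncomputable def chordProd (T : ℕ) (q : Fin k → ℤ) : ℝ :=
  ∏ i, ∏ j ∈ Finset.Ioi i, 2 * Real.sin (Real.pi * (q j - q i) / T)

theorem chordProd_pos {q : Fin k → ℤ} (hq : CycMono T q) : 0 < chordProd T q := by
  refine Finset.prod_pos fun i _ => Finset.prod_pos fun j hj => mul_pos two_pos ?_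
  have h1 : (0 : ℝ) < q j - q i := by
    have := hq.strictMono (Finset.mem_Ioi.mp hj)
    rw [sub_pos]
    exact_mod_cast this
  have h2 : ((q j : ℝ) - q i) < T := by
    have : (q j : ℝ) < q i + T := by exact_mod_cast hq.lt_add j i
    linarith
  have hT : (0 : ℝ) < T := h1.trans h2
  refine Real.sin_pos_of_pos_of_lt_pi (by positivity) ?_
  rw [div_lt_iff₀ hT]
  exact mul_lt_mul_of_pos_left h2 Real.pi_pos

theorem exp_zpow_sub_exp_zpow (T : ℕ) (a b : ℤ) :
    Complex.exp (2 * Real.pi * Complex.I / T) ^ b - Complex.exp (2 * Real.pi * Complex.I / T) ^ a =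
      (Complex.exp (Real.pi * Complex.I / T) ^ a * Complex.exp (Real.pi * Complex.I / T) ^ b) *
        (Complex.I * ((2 * Real.sin (Real.pi * (b - a) / T) : ℝ) : ℂ)) := by
  have h2 : ∀ x : ℂ, Complex.I * (2 * Complex.sin x) =
      Complex.exp (x * Complex.I) - Complex.exp (-x * Complex.I) := fun x => by
    rw [Complex.two_sin, mul_comm, mul_assoc, Complex.I_mul_I]
    ring
  push_cast
  rw [h2]
  simp only [← Complex.exp_int_mul]
  rw [← Complex.exp_add, mul_sub, ← Complex.exp_add, ← Complex.exp_add]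
  congr 2 <;> ring

/-- The common phase of the minors `det (exp (2πi (l - m) q_i / T))`. -/
noncomputable def chordPhase (k : ℕ) : ℂ := ∏ i : Fin k, ∏ _j ∈ Finset.Ioi i, Complex.I

theorem chordPhase_mul_conj (k : ℕ) : chordPhase k * (starRingEnd ℂ) (chordPhase k) = 1 := by
  simp [chordPhase, map_prod, ← Finset.prod_mul_distrib, ← mul_pow]

/-- In the Vandermonde product every difference of roots of unity is a half-angle phase times I
times a chord. The half-angle phases of q i multiply to η^(2m q i), which the centring of the
frequencies at m cancels exactly. -/
theorem det_unityChar_low (q : Fin (2 * m + 1) → ℤ) :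
    (Matrix.of fun i l : Fin (2 * m + 1) => unityChar T m (l : ℕ) (q i)).det =
      chordPhase (2 * m + 1) * chordProd T q := by
  set ω := Complex.exp (2 * Real.pi * Complex.I / T) with hω
  set η := Complex.exp (Real.pi * Complex.I / T) with hη
  have hηω : η ^ 2 = ω := by
    rw [hη, hω, ← Complex.exp_nat_mul]
    congr 1
    push_cast
    ring
  have h1 : (Matrix.of fun i l : Fin (2 * m + 1) => unityChar T m (l : ℕ) (q i)) =
      Matrix.of fun i l => ω ^ (-(m : ℤ) * q i) * Matrix.vandermonde (fun i => ω ^ q i) i l := by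
    ext i l
    rw [Matrix.of_apply, Matrix.of_apply, Matrix.vandermonde_apply, ← zpow_natCast, ← zpow_mul,
      ← zpow_add₀ (Complex.exp_ne_zero _), unityChar]
    congr 1
    ring
  rw [h1, Matrix.det_mul_column, Matrix.det_vandermonde]
  simp only [hω, exp_zpow_sub_exp_zpow]
  simp only [← hω, ← hη]
  have h3 : ∀ i, ω ^ (-(m : ℤ) * q i) * (η ^ q i) ^ (2 * m + 1 - 1) = 1 := fun i => by
    rw [← hηω, ← zpow_natCast η, ← zpow_mul, ← zpow_natCast, ← zpow_mul,
      ← zpow_add₀ (Complex.exp_ne_zero _)]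
    rw [show ((2 : ℕ) : ℤ) * (-(m : ℤ) * q i) + q i * ((2 * m + 1 - 1 : ℕ) : ℤ) = 0 by
      push_cast [Nat.add_sub_cancel]; ring, zpow_zero]
  have h4 := Fin.prod_prod_Ioi_mul fun i => η ^ q i
  have h5 : (∏ i, ω ^ (-(m : ℤ) * q i)) * ∏ i, (η ^ q i) ^ (2 * m + 1 - 1) = 1 := by
    rw [← Finset.prod_mul_distrib]
    exact Finset.prod_eq_one fun i _ => h3 i
  simp only [chordPhase, chordProd, Complex.ofReal_prod]
  simp only [Finset.prod_mul_distrib] at h4 ⊢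
  rw [h4, ← mul_assoc, h5, one_mul]

/-- The consecutive-row minors are summed over all column tuples against W, normalised by its
constant phase. The terms are nonnegative and one is positive, while the sum is a positive multiple
of the coefficient product. -/
theorem prod_coeff_low_pos (hk : 2 * m + 1 ≤ T) {g : ℤ → ℂ} (hg : Function.Periodic g (T : ℤ))
    {c : Fin T → ℂ} (hc : ∀ t, g t = ∑ s : Fin T, c s * unityChar T m (s : ℕ) t)
    (hnn : ∀ q : Fin (2 * m + 1) → ℤ, CycMono T q →
      0 ≤ toeplitzMinor g (fun i => ((i : ℕ) : ℤ)) q)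
    {q₀ : Fin (2 * m + 1) → ℤ} (hq₀ : CycMono T q₀)
    (hpos : toeplitzMinor g (fun i => ((i : ℕ) : ℤ)) q₀ ≠ 0) :
    0 < ∏ l : Fin (2 * m + 1), c (Fin.castLE hk l) := by
  have hT : T ≠ 0 := by omega
  set p₀ : Fin (2 * m + 1) → ℤ := fun i => ((i : ℕ) : ℤ) with hp₀
  set θ := chordPhase (2 * m + 1) with hθ
  let co : (Fin (2 * m + 1) → Fin T) → Fin (2 * m + 1) → ℤ := fun ψ l => ((ψ l : ℕ) : ℤ)
  let W : (Fin (2 * m + 1) → ℤ) → ℂ := fun q =>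
    (Matrix.of fun i l : Fin (2 * m + 1) => unityChar T m (l : ℕ) (q i)).det
  have hWperm : ∀ (q : Fin (2 * m + 1) → ℤ) (σ : Equiv.Perm (Fin (2 * m + 1))),
      W (q ∘ σ) = Equiv.Perm.sign σ * W q := fun q σ => by
    simp only [W]
    rw [← Matrix.det_permute]
    rfl
  -- Both factors are alternating in the columns, so their product may be evaluated on the sorted
  -- tuple.
  have hterm : ∀ (ψ : Fin (2 * m + 1) → Fin T) (σ : Equiv.Perm (Fin (2 * m + 1))),
      toeplitzMinor g p₀ (co ψ ∘ σ) * ((starRingEnd ℂ) θ * W (co ψ ∘ σ)) =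
      toeplitzMinor g p₀ (co ψ) * ((starRingEnd ℂ) θ * W (co ψ)) := fun ψ σ => by
    rw [hWperm, toeplitzMinor_perm_right]
    rcases Int.units_eq_one_or (Equiv.Perm.sign σ) with h | h <;> simp [h]
  have hWpos : ∀ q, CycMono T q → 0 < (starRingEnd ℂ) θ * W q := fun q hq => by
    simp only [W]
    rw [det_unityChar_low, ← mul_assoc, mul_comm _ (chordPhase _), chordPhase_mul_conj, one_mul]
    exact_mod_cast chordProd_pos hq
  have hterm_nn : ∀ ψ, 0 ≤ toeplitzMinor g p₀ (co ψ) * ((starRingEnd ℂ) θ * W (co ψ)) := by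
    intro ψ
    by_cases hψ : Function.Injective ψ
    · obtain ⟨σ, hσ⟩ := exists_perm_cycMono hψ
      rw [← hterm ψ σ]
      exact mul_nonneg (hnn _ hσ) (hWpos _ hσ).le
    · obtain ⟨i, j, hij, hne⟩ := Function.not_injective_iff.mp hψ
      rw [toeplitzMinor_eq_zero_of_dvd hg p₀ hne (by simp [co, hij]), zero_mul]
  have hsum_pos : 0 < ∑ ψ, toeplitzMinor g p₀ (co ψ) * ((starRingEnd ℂ) θ * W (co ψ)) := by
    obtain ⟨e, he⟩ := hq₀.exists_orderEmb (even_two_mul m)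
    refine Finset.sum_pos' (fun ψ _ => hterm_nn ψ) ⟨e, Finset.mem_univ _, ?_⟩
    have h1 : toeplitzMinor g p₀ q₀ = toeplitzMinor g p₀ (co e) :=
      toeplitzMinor_eq_of_evenRearr_right hg p₀ he
    have he' : CycMono T (co e) := cycMono_orderEmb e
    exact mul_pos (lt_of_le_of_ne (hnn _ he') (h1 ▸ hpos).symm) (hWpos _ he')
  have hS := prod_mul_det_unityChar hT hc p₀ fun l => Fin.castLE hk l
  have hsymm : ∀ σ : Equiv.Perm (Fin (2 * m + 1)),
      ∑ ψ : Fin (2 * m + 1) → Fin T, (∏ l : Fin (2 * m + 1), unityChar T m (l : ℕ) (ψ l : ℕ)) *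
        toeplitzMinor g p₀ (co ψ) =
      ∑ ψ : Fin (2 * m + 1) → Fin T, toeplitzMinor g p₀ (co ψ) * (Equiv.Perm.sign σ •
        ∏ l : Fin (2 * m + 1), unityChar T m (l : ℕ) (ψ (σ l) : ℕ)) := fun σ => by
    rw [← (Equiv.arrowCongr σ.symm (Equiv.refl (Fin T))).sum_comp]
    refine Finset.sum_congr rfl fun ψ _ => ?_
    have h1 : co ((Equiv.arrowCongr σ.symm (Equiv.refl (Fin T))) ψ) = co ψ ∘ σ := rfl
    rw [h1, toeplitzMinor_perm_right, Units.smul_def, zsmul_eq_mul]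
    simp only [Equiv.arrowCongr_apply, Equiv.symm_symm, Function.comp_apply,
      Equiv.coe_refl, id_eq]
    ring
  -- Expanding W by the Leibniz formula gives one sum per permutation, all equal by `hsymm`; hence
  -- the factorial.
  have hfact : ((2 * m + 1).factorial : ℂ) *
      ∑ ψ : Fin (2 * m + 1) → Fin T, (∏ l : Fin (2 * m + 1), unityChar T m (l : ℕ) (ψ l : ℕ)) *
        toeplitzMinor g p₀ (co ψ) = ∑ ψ, toeplitzMinor g p₀ (co ψ) * W (co ψ) := by
    have h1 : ∀ ψ, W (co ψ) = ∑ σ : Equiv.Perm (Fin (2 * m + 1)), Equiv.Perm.sign σ •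
        ∏ l : Fin (2 * m + 1), unityChar T m (l : ℕ) (ψ (σ l) : ℕ) := fun ψ => Matrix.det_apply _
    simp only [h1, Finset.mul_sum]
    rw [Finset.sum_comm]
    simp only [← hsymm]
    rw [Finset.sum_const, Finset.card_univ, Fintype.card_perm, Fintype.card_fin, nsmul_eq_mul,
      Finset.mul_sum]
  have hfinal : ∑ ψ, toeplitzMinor g p₀ (co ψ) * ((starRingEnd ℂ) θ * W (co ψ)) =
      ((2 * m + 1).factorial * (T : ℂ) ^ (2 * m + 1) * ((starRingEnd ℂ) θ * W p₀)) *
        ∏ l : Fin (2 * m + 1), c (Fin.castLE hk l) := by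
    have h1 : ∀ ψ, toeplitzMinor g p₀ (co ψ) * ((starRingEnd ℂ) θ * W (co ψ)) =
        (starRingEnd ℂ) θ * (toeplitzMinor g p₀ (co ψ) * W (co ψ)) := fun ψ => by ring
    simp only [h1]
    rw [← Finset.mul_sum, ← hfact]
    simp only [Fin.val_castLE] at hS
    simp only [co, W]
    rw [← hS, Finset.prod_mul_distrib, Finset.prod_const, Finset.card_univ, Fintype.card_fin]
    ring
  rw [hfinal] at hsum_pos
  refine (pos_iff_pos_of_mul_pos hsum_pos).mp ?_
  have hTpos : (0 : ℂ) < T := by exact_mod_cast Nat.pos_of_ne_zero hT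
  have hf : (0 : ℂ) < ((2 * m + 1).factorial : ℕ) := by exact_mod_cast Nat.factorial_pos _
  exact mul_pos (mul_pos hf (pow_pos hTpos _)) (hWpos _ (cycMono_coe hk))

end LowFrequencies

open Filter Topology

/-! ### Dominance of the low frequencies under repeated convolution -/

section Asymptotics

/-- The matrix factors as P D (diagonal c + E) Q with D the diagonal matrix of the powers μ^n. The
entries of E are combinations of (ν / μ)^n and tend to zero. -/
theorem Matrix.tendsto_det_div_prod_pow {k r : ℕ} {P Q : Matrix (Fin k) (Fin k) ℂ}
    (hP : P.det ≠ 0) (hQ : Q.det ≠ 0) (c : Fin k → ℂ) {μ : Fin k → ℝ} (hμ : ∀ l, 0 < μ l)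
    (d : Fin r → ℂ) {ν : Fin r → ℝ} (hν : ∀ s, 0 ≤ ν s) (hlt : ∀ s l, ν s < μ l)
    (u v : Fin r → Fin k → ℂ) :
    Tendsto (fun n : ℕ => (Matrix.of fun i j => ∑ l, c l * (μ l : ℂ) ^ n * (P i l * Q l j) +
      ∑ s, d s * (ν s : ℂ) ^ n * (u s i * v s j)).det / (∏ l, (μ l : ℂ)) ^ n) atTop
      (𝓝 (P.det * (∏ l, c l) * Q.det)) := by
  have hμC : ∀ l, (μ l : ℂ) ≠ 0 := fun l => by exact_mod_cast (hμ l).ne'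
  let H : ℕ → Matrix (Fin k) (Fin k) ℂ := fun n =>
    Matrix.of fun i j => ∑ s, d s * (ν s : ℂ) ^ n * (u s i * v s j)
  let D : ℕ → Matrix (Fin k) (Fin k) ℂ := fun n => Matrix.diagonal fun l => (μ l : ℂ) ^ n
  let D' : ℕ → Matrix (Fin k) (Fin k) ℂ := fun n => Matrix.diagonal fun l => ((μ l : ℂ) ^ n)⁻¹
  let E : ℕ → Matrix (Fin k) (Fin k) ℂ := fun n => D' n * P⁻¹ * H n * Q⁻¹
  have hDD' : ∀ n, D n * D' n = 1 := fun n => by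
    simp only [D, D', Matrix.diagonal_mul_diagonal, mul_inv_cancel₀ (pow_ne_zero n (hμC _))]
    exact Matrix.diagonal_one
  have hPu : IsUnit P.det := isUnit_iff_ne_zero.mpr hP
  have hQu : IsUnit Q.det := isUnit_iff_ne_zero.mpr hQ
  have hfac : ∀ n, (Matrix.of fun i j => ∑ l, c l * (μ l : ℂ) ^ n * (P i l * Q l j) +
      ∑ s, d s * (ν s : ℂ) ^ n * (u s i * v s j)) =
      P * D n * (Matrix.diagonal c + E n) * Q := fun n => by
    have h1 : P * D n * E n * Q = H n := by
      calc P * D n * (D' n * P⁻¹ * H n * Q⁻¹) * Q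
          = P * (D n * D' n) * P⁻¹ * H n * (Q⁻¹ * Q) := by simp only [Matrix.mul_assoc]
        _ = H n := by
          rw [hDD', Matrix.mul_one, Matrix.mul_nonsing_inv _ hPu, Matrix.nonsing_inv_mul _ hQu,
            Matrix.one_mul, Matrix.mul_one]
    rw [Matrix.mul_add, Matrix.add_mul, h1]
    ext i j
    simp only [Matrix.of_apply, Matrix.add_apply, H]
    congr 1
    rw [Matrix.mul_assoc P, Matrix.diagonal_mul_diagonal, Matrix.mul_apply]
    refine Finset.sum_congr rfl fun l _ => ?_
    rw [Matrix.mul_diagonal]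
    ring
  have hE : Tendsto E atTop (𝓝 0) := by
    refine tendsto_pi_nhds.mpr fun l => tendsto_pi_nhds.mpr fun l' => ?_
    have h1 : ∀ n, E n l l' = ∑ j, ∑ i, ∑ s, (P⁻¹ l i * d s * u s i * v s j * Q⁻¹ j l') *
        ((ν s / μ l : ℝ) : ℂ) ^ n := fun n => by
      simp only [E, D', H]
      rw [Matrix.mul_apply]
      refine Finset.sum_congr rfl fun j _ => ?_
      rw [Matrix.mul_apply, Finset.sum_mul]
      refine Finset.sum_congr rfl fun i _ => ?_
      rw [Matrix.diagonal_mul, Matrix.of_apply, Finset.mul_sum, Finset.sum_mul]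
      refine Finset.sum_congr rfl fun s _ => ?_
      push_cast
      rw [div_pow]
      have := pow_ne_zero n (hμC l)
      field_simp
    simp only [h1]
    have h2 : (0 : Matrix (Fin k) (Fin k) ℂ) l l' = ∑ j : Fin k, ∑ i : Fin k, ∑ s : Fin r,
        (P⁻¹ l i * d s * u s i * v s j * Q⁻¹ j l') * 0 := by simp
    rw [h2]
    refine tendsto_finsetSum _ fun j _ => tendsto_finsetSum _ fun i _ =>
      tendsto_finsetSum _ fun s _ => tendsto_const_nhds.mul ?_
    refine tendsto_pow_atTop_nhds_zero_of_norm_lt_one ?_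
    rw [Complex.norm_real, Real.norm_of_nonneg (div_nonneg (hν s) (hμ l).le), div_lt_one (hμ l)]
    exact hlt s l
  have hlim : Tendsto (fun n => P.det * (Matrix.diagonal c + E n).det * Q.det) atTop
      (𝓝 (P.det * (Matrix.diagonal c + 0).det * Q.det)) := by
    have hdet : Continuous fun M : Matrix (Fin k) (Fin k) ℂ => M.det :=
      Continuous.matrix_det continuous_id
    exact ((hdet.tendsto _).comp (tendsto_const_nhds.add hE)).const_mul _ |>.mul_const _
  rw [add_zero, Matrix.det_diagonal] at hlim
  refine hlim.congr fun n => ?_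
  rw [hfac, Matrix.det_mul, Matrix.det_mul, Matrix.det_mul, Matrix.det_diagonal,
    Finset.prod_pow, eq_div_iff (pow_ne_zero n (Finset.prod_ne_zero_iff.mpr fun l _ => hμC l))]
  ring

variable {T m : ℕ}

/-- The eigenvalue of the convolution with `z + 2 + z⁻¹` at the frequency `s - m`. -/
noncomputable def freqGain (T m s : ℕ) : ℝ := 2 + 2 * Real.cos (2 * Real.pi * (s - m) / T)

theorem freqGain_nonneg (T m s : ℕ) : 0 ≤ freqGain T m s := by
  have := Real.neg_one_le_cos (2 * Real.pi * (s - m) / T)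
  unfold freqGain
  linarith

theorem cos_le_of_low (hk : 2 * m + 1 ≤ T) {l : ℕ} (hl : l < 2 * m + 1) :
    Real.cos (2 * Real.pi * m / T) ≤ Real.cos (2 * Real.pi * (l - m) / T) := by
  have hT : (0 : ℝ) < T := by exact_mod_cast (by omega : 0 < T)
  rw [← Real.cos_abs (2 * Real.pi * (l - m) / T), abs_div, abs_mul, abs_of_pos hT,
    abs_of_pos Real.two_pi_pos]
  have h1 : |(l : ℝ) - m| ≤ m := by
    rw [abs_le]
    have : (l : ℝ) ≤ 2 * m := by exact_mod_cast Nat.lt_succ_iff.mp hl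
    constructor <;> linarith [(Nat.cast_nonneg l : (0 : ℝ) ≤ l)]
  have h2 : (2 * m + 1 : ℝ) ≤ T := by exact_mod_cast hk
  refine Real.cos_le_cos_of_nonneg_of_le_pi (by positivity) ?_ ?_
  · rw [div_le_iff₀ hT]
    nlinarith [Real.pi_pos]
  · gcongr

theorem freqGain_pos (hk : 2 * m + 1 ≤ T) {l : ℕ} (hl : l < 2 * m + 1) : 0 < freqGain T m l := by
  have hT : (0 : ℝ) < T := by exact_mod_cast (by omega : 0 < T)
  have h1 := cos_le_of_low hk hl
  have h2 : (2 * m + 1 : ℝ) ≤ T := by exact_mod_cast hk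
  have h3 : Real.cos Real.pi < Real.cos (2 * Real.pi * m / T) := by
    refine Real.cos_lt_cos_of_nonneg_of_le_pi (by positivity) le_rfl ?_
    rw [div_lt_iff₀ hT]
    nlinarith [Real.pi_pos]
  rw [Real.cos_pi] at h3
  unfold freqGain
  linarith

/-- The remaining frequencies s - m lie between m + 1 and T - m - 1, so modulo T they are farther
from 0 than m. -/
theorem freqGain_lt (hk : 2 * m + 1 ≤ T) {l s : ℕ} (hl : l < 2 * m + 1) (hs : 2 * m + 1 ≤ s)
    (hsT : s < T) : freqGain T m s < freqGain T m l := by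
  have hT : (0 : ℝ) < T := by exact_mod_cast (by omega : 0 < T)
  have h1 := cos_le_of_low hk hl
  have hpi := Real.pi_pos
  have hs1 : (2 * m + 1 : ℝ) ≤ s := by exact_mod_cast hs
  have hs2 : (s + 1 : ℝ) ≤ T := by exact_mod_cast hsT
  have key : ∀ x : ℝ, (m : ℝ) < x → 2 * x ≤ T →
      Real.cos (2 * Real.pi * x / T) < Real.cos (2 * Real.pi * m / T) := fun x hx hxT => by
    refine Real.cos_lt_cos_of_nonneg_of_le_pi (by positivity) ?_ ?_
    · rw [div_le_iff₀ hT]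
      nlinarith
    · gcongr
  have h2 : Real.cos (2 * Real.pi * (s - m) / T) < Real.cos (2 * Real.pi * m / T) := by
    -- Past half a period, the frequency x is reflected to T - x, which has the same cosine.
    rcases le_total (2 * ((s : ℝ) - m)) T with h | h
    · exact key _ (by linarith) h
    · have := key (T - (s - m)) (by linarith) (by linarith)
      rwa [show 2 * Real.pi * (T - ((s : ℝ) - m)) / T = 2 * Real.pi - 2 * Real.pi * (s - m) / T by
        field_simp, Real.cos_two_pi_sub] at this
  unfold freqGain
  linarith

theorem bidiagStep_iterate_eq_sum {g : ℤ → ℂ} {c : Fin T → ℂ}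
    (hc : ∀ t, g t = ∑ s : Fin T, c s * unityChar T m (s : ℕ) t) (n : ℕ) (t : ℤ) :
    (bidiagStep 1)^[n] g t =
      ∑ s : Fin T, c s * (1 + unityChar T m (s : ℕ) (-1)) ^ n * unityChar T m (s : ℕ) t := by
  induction n generalizing t with
  | zero => simp [hc]
  | succ n ih =>
    rw [Function.iterate_succ_apply', bidiagStep, ih, ih, one_mul, ← Finset.sum_add_distrib]
    refine Finset.sum_congr rfl fun s _ => ?_
    rw [unityChar_sub]
    ring

theorem unityChar_mul_gain (s : ℕ) :
    (1 + unityChar T m s (-1)) ^ 2 * unityChar T m s 1 = (freqGain T m s : ℂ) := by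
  have h1 : unityChar T m s 1 = Complex.exp ((2 * Real.pi * (s - m) / T : ℝ) * Complex.I) := by
    rw [unityChar, ← Complex.exp_int_mul]
    congr 1
    push_cast
    ring
  have h2 : unityChar T m s (-1) =
      Complex.exp (-(2 * Real.pi * (s - m) / T : ℝ) * Complex.I) := by
    rw [unityChar, ← Complex.exp_int_mul]
    congr 1
    push_cast
    ring
  have h3 : unityChar T m s (-1) * unityChar T m s 1 = 1 := by
    rw [h1, h2, ← Complex.exp_add]
    simp
  have h4 : (freqGain T m s : ℂ) = 2 + (unityChar T m s 1 + unityChar T m s (-1)) := by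
    rw [h1, h2, ← Complex.two_cos, freqGain]
    push_cast
    ring
  rw [h4]
  linear_combination (2 + unityChar T m s (-1)) * h3

theorem bidiagStep_iterate_two_mul {g : ℤ → ℂ} {c : Fin T → ℂ}
    (hc : ∀ t, g t = ∑ s : Fin T, c s * unityChar T m (s : ℕ) t) (n : ℕ) (t : ℤ) :
    (bidiagStep 1)^[2 * n] g (t + n) =
      ∑ s : Fin T, c s * (freqGain T m s : ℂ) ^ n * unityChar T m (s : ℕ) t := by
  rw [bidiagStep_iterate_eq_sum hc]
  refine Finset.sum_congr rfl fun s _ => ?_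
  have h1 : unityChar T m (s : ℕ) (n : ℤ) = unityChar T m (s : ℕ) 1 ^ n := by
    rw [unityChar, unityChar, mul_one, zpow_mul, zpow_natCast]
  rw [← unityChar_mul_gain, unityChar_add, h1, mul_pow, ← pow_mul]
  ring

theorem im_toeplitzMinor_iterate {k : ℕ} {g : ℤ → ℂ}
    (hreal : ∀ p q : Fin k → ℤ, (toeplitzMinor g p q).im = 0) (n : ℕ) (p q : Fin k → ℤ) :
    (toeplitzMinor ((bidiagStep 1)^[n] g) p q).im = 0 := by
  induction n generalizing p q with
  | zero => exact hreal p q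
  | succ n ih =>
    rw [Function.iterate_succ_apply', ← Complex.ofReal_one]
    exact im_toeplitzMinor_bidiagStep (by simpa using ih) 1 p q

theorem Function.Periodic.bidiagStep_iterate {g : ℤ → ℂ} (hg : Function.Periodic g (T : ℤ)) (a : ℂ)
    (n : ℕ) : Function.Periodic ((_root_.bidiagStep a)^[n] g) (T : ℤ) := by
  induction n with
  | zero => exact hg
  | succ n ih =>
    rw [Function.iterate_succ_apply']
    exact ih.bidiagStep a

/-- The column shift by n recentres (1 + z)^(2n), so that the multipliers become the real gains. The
phases of the two character determinants are conjugate and cancel. -/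
theorem tendsto_toeplitzMinor_iterate (hk : 2 * m + 1 ≤ T) {g : ℤ → ℂ} {c : Fin T → ℂ}
    (hc : ∀ t, g t = ∑ s : Fin T, c s * unityChar T m (s : ℕ) t)
    {p q : Fin (2 * m + 1) → ℤ} (hp : CycMono T p) (hq : CycMono T q) :
    Tendsto (fun n : ℕ => toeplitzMinor ((bidiagStep 1)^[2 * n] g) p (fun i => q i - n) /
      (∏ l : Fin (2 * m + 1), (freqGain T m l : ℂ)) ^ n) atTop
      (𝓝 ((chordProd T p * chordProd T q : ℝ) * ∏ l : Fin (2 * m + 1), c (Fin.castLE hk l))) := by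
  obtain ⟨r, rfl⟩ := Nat.exists_eq_add_of_le hk
  let W : (Fin (2 * m + 1) → ℤ) → Matrix (Fin (2 * m + 1)) (Fin (2 * m + 1)) ℂ := fun q =>
    Matrix.of fun i l => unityChar (2 * m + 1 + r) m (l : ℕ) (q i)
  have hW : ∀ q, (W q).det = chordPhase (2 * m + 1) * chordProd (2 * m + 1 + r) q :=
    det_unityChar_low
  have hW' : ∀ q, (W fun i => -q i).transpose.det =
      (starRingEnd ℂ) (chordPhase (2 * m + 1)) * chordProd (2 * m + 1 + r) q := fun q => by
    rw [Matrix.det_transpose]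
    have h1 : (W fun i => -q i) = (W q).map (starRingEnd ℂ) := by
      ext i l
      simp only [W, Matrix.of_apply, Matrix.map_apply, unityChar, map_zpow₀, mul_neg, zpow_neg,
        ← inv_zpow]
      congr 1
      rw [← Complex.exp_neg, ← Complex.exp_conj]
      congr 1
      have h2 : (starRingEnd ℂ) 2 = 2 := Complex.conj_ofNat 2
      simp [neg_div, h2]
    rw [h1, ← RingHom.mapMatrix_apply, ← RingHom.map_det, hW, map_mul, Complex.conj_ofReal]
  have hph := chordPhase_mul_conj (2 * m + 1)
  have hpp := chordProd_pos hp
  have hqp := chordProd_pos hq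
  have hθ : chordPhase (2 * m + 1) ≠ 0 := left_ne_zero_of_mul_eq_one hph
  have hθ' : (starRingEnd ℂ) (chordPhase (2 * m + 1)) ≠ 0 := right_ne_zero_of_mul_eq_one hph
  have key := Matrix.tendsto_det_div_prod_pow (P := W p) (Q := (W fun i => -q i).transpose)
    (by rw [hW]; exact mul_ne_zero hθ (by exact_mod_cast hpp.ne'))
    (by rw [hW']; exact mul_ne_zero hθ' (by exact_mod_cast hqp.ne'))
    (fun l => c (Fin.castAdd r l)) (μ := fun l => freqGain (2 * m + 1 + r) m l)
    (fun l => freqGain_pos hk l.2) (fun s => c (Fin.natAdd (2 * m + 1) s))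
    (ν := fun s => freqGain (2 * m + 1 + r) m (2 * m + 1 + s)) (fun s => freqGain_nonneg _ _ _)
    (fun s l => freqGain_lt hk l.2 (by omega) (by omega))
    (fun s i => unityChar (2 * m + 1 + r) m ((2 * m + 1 + s : ℕ) : ℤ) (p i))
    (fun s j => unityChar (2 * m + 1 + r) m ((2 * m + 1 + s : ℕ) : ℤ) (-q j))
  rw [hW, hW'] at key
  convert key using 2
  · rename_i n
    congr 1
    rw [toeplitzMinor]
    congr 1
    ext i j
    rw [Matrix.of_apply, Matrix.of_apply, show p i - (q j - (n : ℤ)) = p i - q j + n by ring,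
      bidiagStep_iterate_two_mul hc, Fin.sum_univ_add]
    simp only [unityChar_sub, W, Matrix.of_apply, Matrix.transpose_apply, Fin.val_castAdd,
      Fin.val_natAdd]
  · have h1 : ∀ l, Fin.castLE hk l = Fin.castAdd r l := fun l => rfl
    simp only [h1]
    push_cast
    linear_combination (-(chordProd (2 * m + 1 + r) p : ℂ) * chordProd (2 * m + 1 + r) q *
      ∏ l, c (Fin.castAdd r l)) * hph

/-- After sufficiently many convolutions with `1 + z` all minors are positive. -/
theorem exists_iterate_toeplitzMinor_pos (hk : 2 * m + 1 ≤ T) {g : ℤ → ℂ}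
    (hg : Function.Periodic g (T : ℤ))
    (hnn : ∀ q : Fin (2 * m + 1) → ℤ, CycMono T q →
      0 ≤ toeplitzMinor g (fun i => ((i : ℕ) : ℤ)) q)
    {q₀ : Fin (2 * m + 1) → ℤ} (hq₀ : CycMono T q₀)
    (hpos : toeplitzMinor g (fun i => ((i : ℕ) : ℤ)) q₀ ≠ 0) :
    ∃ N : ℕ, ∀ p q : Fin (2 * m + 1) → ℤ, CycMono T p → CycMono T q →
      0 < toeplitzMinor ((bidiagStep 1)^[2 * N] g) p q := by
  have hT : T ≠ 0 := by omega
  obtain ⟨c, hc⟩ := exists_eq_sum_unityChar hT m hg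
  have hκ := prod_coeff_low_pos hk hg hc hnn hq₀ hpos
  have hreal := im_toeplitzMinor_eq_zero hg hT hnn
  set M : ℝ := ∏ l : Fin (2 * m + 1), freqGain T m l with hM
  have hMpos : 0 < M := Finset.prod_pos fun l _ => freqGain_pos hk l.2
  have hev : ∀ p q : Fin (2 * m + 1) → ℤ, CycMono T p → CycMono T q →
      ∀ᶠ n : ℕ in atTop, 0 < toeplitzMinor ((bidiagStep 1)^[2 * n] g) p fun i => q i - n := by
    intro p q hp hq
    have hlim := (Complex.continuous_re.tendsto _).comp (tendsto_toeplitzMinor_iterate hk hc hp hq)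
    have hre : 0 < ((chordProd T p * chordProd T q : ℝ) *
        ∏ l : Fin (2 * m + 1), c (Fin.castLE hk l)).re := by
      rw [Complex.re_ofReal_mul]
      exact mul_pos (mul_pos (chordProd_pos hp) (chordProd_pos hq)) (Complex.pos_iff.mp hκ).1
    filter_upwards [hlim.eventually (lt_mem_nhds hre)] with n hn
    rw [Function.comp_apply, ← Complex.ofReal_prod, ← hM, ← Complex.ofReal_pow,
      Complex.div_ofReal_re] at hn
    refine Complex.pos_iff.mpr ⟨?_, (im_toeplitzMinor_iterate hreal _ _ _).symm⟩
    exact (div_pos_iff_of_pos_right (pow_pos hMpos n)).mp hn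
  have : Finite (Fin (2 * m + 1) ↪o Fin T) := DFunLike.finite _
  -- Only finitely many pairs of order embeddings occur, so one N serves them all.
  have hall : ∀ᶠ n : ℕ in atTop, ∀ e e' : Fin (2 * m + 1) ↪o Fin T,
      0 < toeplitzMinor ((bidiagStep 1)^[2 * n] g) (fun i => ((e i : ℕ) : ℤ))
        fun i => ((e' i : ℕ) : ℤ) - n :=
    eventually_all.mpr fun e => eventually_all.mpr fun e' =>
      hev _ _ (cycMono_orderEmb e) (cycMono_orderEmb e')
  obtain ⟨N, hN⟩ := hall.exists
  refine ⟨N, fun p q hp hq => ?_⟩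
  obtain ⟨e, he⟩ := hp.exists_orderEmb (even_two_mul m)
  -- The tuple q + N compensates for the shift by -N in the asymptotics.
  obtain ⟨e', he'⟩ := (hq.add_const N).exists_orderEmb (even_two_mul m)
  have hgN := hg.bidiagStep_iterate 1 (2 * N)
  have h1 := hN e e'
  rw [← toeplitzMinor_add, ← toeplitzMinor_eq_of_evenRearr_right hgN _ he',
    toeplitzMinor_add] at h1
  simp only [add_sub_cancel_right] at h1
  rwa [toeplitzMinor_eq_of_evenRearr_left hgN _ he]

end Asymptotics

/-! ### Descent to the original sequence and the limit a → 0 -/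

section SignConsistency

variable {T m : ℕ} {g : ℤ → ℂ}

theorem toeplitzMinor_iterate_consecutive_pos {k : ℕ} (hg : Function.Periodic g (T : ℤ))
    (hint : ∀ q : Fin k → ℤ, CycMono T q → 0 < toeplitzMinor g (fun i => ((i : ℕ) : ℤ)) q) (n : ℕ)
    (q : Fin k → ℤ) (hq : CycMono T q) :
    0 < toeplitzMinor ((bidiagStep 1)^[n] g) (fun i => ((i : ℕ) : ℤ)) q := by
  induction n generalizing q with
  | zero => exact hint q hq
  | succ n ih =>
    rw [Function.iterate_succ_apply']
    exact (ih q hq).trans_le (le_toeplitzMinor_bidiagStep (hg.bidiagStep_iterate 1 n)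
      (fun q hq => (ih q hq).le) zero_le_one hq)

/-- If the minors with consecutive rows are positive, then so are all minors. -/
theorem toeplitzMinor_pos_of_consecutive_pos (hk : 2 * m + 1 ≤ T)
    (hg : Function.Periodic g (T : ℤ))
    (hint : ∀ q : Fin (2 * m + 1) → ℤ, CycMono T q →
      0 < toeplitzMinor g (fun i => ((i : ℕ) : ℤ)) q)
    {p q : Fin (2 * m + 1) → ℤ} (hp : CycMono T p) (hq : CycMono T q) :
    0 < toeplitzMinor g p q := by
  have hT : T ≠ 0 := by omega
  obtain ⟨N, hN⟩ := exists_iterate_toeplitzMinor_pos hk hg (fun q hq => (hint q hq).le) hq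
    (hint q hq).ne'
  have hreal := im_toeplitzMinor_eq_zero hg hT fun q hq => (hint q hq).le
  suffices h : ∀ n, (∀ p q : Fin (2 * m + 1) → ℤ, CycMono T p → CycMono T q →
      0 < toeplitzMinor ((bidiagStep 1)^[n] g) p q) → ∀ p q : Fin (2 * m + 1) → ℤ,
      CycMono T p → CycMono T q → 0 < toeplitzMinor g p q from h _ hN p q hp hq
  intro n
  induction n with
  | zero => exact id
  | succ n ih =>
    intro h
    refine ih fun p q hp hq => ?_
    exact toeplitzMinor_pos_of_bidiagStep (even_two_mul m) (hg.bidiagStep_iterate 1 n)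
      (im_toeplitzMinor_iterate hreal n) (toeplitzMinor_iterate_consecutive_pos hg hint n)
      (fun p q hp hq => by
        rw [← Function.iterate_succ_apply' (bidiagStep 1)]
        exact h p q hp hq) hp hq

/-- Each step costs at most a factor a^k. The bound transfers strict positivity from convolution
with (1 + z)^n to convolution with (1 + a z)^n for small a > 0. -/
theorem pow_mul_toeplitzMinor_iterate_le {k : ℕ} (hg : Function.Periodic g (T : ℤ))
    (hnn : ∀ q : Fin k → ℤ, CycMono T q → 0 ≤ toeplitzMinor g (fun i => ((i : ℕ) : ℤ)) q)
    {a : ℂ} (ha : 0 ≤ a) (ha1 : a ≤ 1) (n : ℕ) (q : Fin k → ℤ) (hq : CycMono T q) :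
    0 ≤ toeplitzMinor ((bidiagStep 1)^[n] g) (fun i => ((i : ℕ) : ℤ)) q ∧
      (a ^ k) ^ n * toeplitzMinor ((bidiagStep 1)^[n] g) (fun i => ((i : ℕ) : ℤ)) q ≤
        toeplitzMinor ((bidiagStep a)^[n] g) (fun i => ((i : ℕ) : ℤ)) q := by
  induction n generalizing q with
  | zero => exact ⟨hnn q hq, by simp⟩
  | succ n ih =>
    simp only [Function.iterate_succ_apply']
    refine ⟨(ih q hq).1.trans (le_toeplitzMinor_bidiagStep (hg.bidiagStep_iterate 1 n)
      (fun q hq => (ih q hq).1) zero_le_one hq), ?_⟩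
    rw [pow_succ' (a ^ k)]
    exact toeplitzMinor_bidiagStep_le (hg.bidiagStep_iterate 1 n) (hg.bidiagStep_iterate a n)
      ha ha1 (fun q hq => (ih q hq).1) (pow_nonneg (pow_nonneg ha _) _)
      (fun q hq => (ih q hq).2) hq

theorem continuous_bidiagStep_iterate (g : ℤ → ℂ) (n : ℕ) (t : ℤ) :
    Continuous fun a : ℂ => (bidiagStep a)^[n] g t := by
  induction n generalizing t with
  | zero => exact continuous_const
  | succ n ih =>
    simp only [Function.iterate_succ_apply', bidiagStep]
    exact (ih t).add (continuous_id.mul (ih (t - 1)))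

/-- If the minors with consecutive rows are nonnegative, then so are all minors. -/
theorem toeplitzMinor_nonneg_of_consecutive (hk : 2 * m + 1 ≤ T)
    (hg : Function.Periodic g (T : ℤ))
    (hnn : ∀ q : Fin (2 * m + 1) → ℤ, CycMono T q →
      0 ≤ toeplitzMinor g (fun i => ((i : ℕ) : ℤ)) q)
    {p q : Fin (2 * m + 1) → ℤ} (hp : CycMono T p) (hq : CycMono T q) :
    0 ≤ toeplitzMinor g p q := by
  have hT : T ≠ 0 := by omega
  by_cases h0 : ∀ q : Fin (2 * m + 1) → ℤ, CycMono T q →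
      toeplitzMinor g (fun i => ((i : ℕ) : ℤ)) q = 0
  · have hz : ∀ p q : Fin (2 * m + 1) → ℤ, toeplitzMinor (fun _ => 0) p q = 0 := fun p q =>
      Matrix.det_eq_zero_of_row_eq_zero 0 fun _ => rfl
    -- The consecutive-row minors agree with those of the zero sequence, so all minors do.
    rw [toeplitzMinor_eq_of_consecutive_rows (h := fun _ => 0) hg (fun _ => rfl) hT
      (fun q hq => by rw [h0 q hq, hz]) p q, hz]
  · push Not at h0
    obtain ⟨q₀, hq₀, hne⟩ := h0
    obtain ⟨N, hN⟩ := exists_iterate_toeplitzMinor_pos hk hg hnn hq₀ hne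
    -- The perturbed sequence has positive consecutive-row minors, so the strict case applies to it.
    have hpos : ∀ a : ℝ, 0 < a → a < 1 → 0 < toeplitzMinor ((bidiagStep a)^[2 * N] g) p q := by
      intro a ha ha1
      refine toeplitzMinor_pos_of_consecutive_pos hk (hg.bidiagStep_iterate a _) (fun q hq => ?_)
        hp hq
      have haC : (0 : ℂ) < a := by exact_mod_cast ha
      refine lt_of_lt_of_le ?_ (pow_mul_toeplitzMinor_iterate_le hg hnn haC.le
        (by exact_mod_cast ha1.le) (2 * N) q hq).2
      exact mul_pos (pow_pos (pow_pos haC _) _) (hN _ q (cycMono_coe hk) hq)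
    have hcont : Continuous fun a : ℝ => toeplitzMinor ((bidiagStep (a : ℂ))^[2 * N] g) p q :=
      continuous_toeplitzMinor
        (fun t => (continuous_bidiagStep_iterate g (2 * N) t).comp Complex.continuous_ofReal) p q
    have hlim : Tendsto (fun a : ℝ => toeplitzMinor ((bidiagStep (a : ℂ))^[2 * N] g) p q)
        (𝓝[>] 0) (𝓝 (toeplitzMinor ((bidiagStep ((0 : ℝ) : ℂ))^[2 * N] g) p q)) :=
      hcont.continuousWithinAt
    have hid : (bidiagStep ((0 : ℝ) : ℂ))^[2 * N] g = g := by
      refine Function.iterate_fixed ?_ _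
      rw [Complex.ofReal_zero, bidiagStep_zero]
    rw [hid] at hlim
    refine ge_of_tendsto hlim ?_
    filter_upwards [Ioo_mem_nhdsGT one_pos] with a ha
    exact (hpos a ha.1 ha.2).le

theorem det_circulantMatrix_submatrix {k : ℕ} (g : ℤ → ℂ) (p q : Fin k → Fin T) :
    ((circulantMatrix g T).submatrix p q).det =
      toeplitzMinor g (fun i => ((p i : ℕ) : ℤ)) fun i => ((q i : ℕ) : ℤ) := by
  rw [toeplitzMinor]
  congr 1
  ext i j
  simp [circulantMatrix, toeplitzMatrix]

theorem toeplitzMinor_neg_odd (g : ℤ → ℂ) (p q : Fin (2 * m + 1) → ℤ) :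
    toeplitzMinor (fun t => -g t) p q = -toeplitzMinor g p q := by
  have h : (Matrix.of fun i j => -g (p i - q j)) = -Matrix.of fun i j => g (p i - q j) := rfl
  rw [toeplitzMinor, h, Matrix.det_neg, Fintype.card_fin, (odd_two_mul_add_one m).neg_one_pow,
    neg_one_mul]
  rfl

theorem det_circulantMatrix_submatrix_nonneg (hk : 2 * m + 1 ≤ T)
    (hg : Function.Periodic g (T : ℤ))
    (h : ∀ q : Fin (2 * m + 1) ↪o Fin T,
      0 ≤ ((circulantMatrix g T).submatrix (Fin.castLE hk) q).det)
    (p q : Fin (2 * m + 1) ↪o Fin T) : 0 ≤ ((circulantMatrix g T).submatrix p q).det := by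
  rw [det_circulantMatrix_submatrix]
  refine toeplitzMinor_nonneg_of_consecutive hk hg (fun q hq => ?_) (cycMono_orderEmb p)
    (cycMono_orderEmb q)
  obtain ⟨e, he⟩ := hq.exists_orderEmb (even_two_mul m)
  have := h e
  rw [det_circulantMatrix_submatrix] at this
  rw [toeplitzMinor_eq_of_evenRearr_right hg _ he]
  exact this

end SignConsistency

/-! ### The equivalence -/

theorem mainTheorem6 (T k : ℕ) (g : ℤ → ℂ) (hg : Function.Periodic g (T : ℤ))
    (hk_one : 1 ≤ k) (hk_le : k ≤ T) (hk_odd : Odd k) (hTk : T + 1 ≤ 2 * k) :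
    IsSignConsistent k (circulantMatrix g T) ↔
      IsSignConsistent k (firstRows hk_le (circulantMatrix g T)) := by
  have hid : ∀ p : Fin k ↪o Fin k, ⇑p = id := fun p => p.strictMono.eq_id
  have hrows : ∀ (p : Fin k ↪o Fin k) (q : Fin k ↪o Fin T),
      (firstRows hk_le (circulantMatrix g T)).submatrix p q =
        (circulantMatrix g T).submatrix (Fin.castLE hk_le) q := fun p q => by
    rw [hid]
    rfl
  constructor
  · rintro (h | h)
    · exact .inl fun p q => by
        rw [hrows]
        exact h (Fin.castLEOrderEmb hk_le) q
    · exact .inr fun p q => by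
        rw [hrows]
        exact h (Fin.castLEOrderEmb hk_le) q
  · obtain ⟨m, rfl⟩ := hk_odd
    rintro (h | h)
    · refine .inl (det_circulantMatrix_submatrix_nonneg hk_le hg fun q => ?_)
      rw [← hrows (RelEmbedding.refl _)]
      exact h _ q
    · right
      -- Negating g flips every minor of odd order, which reduces the nonpositive case to the
      -- nonnegative one.
      have hneg : ∀ p q : Fin (2 * m + 1) → Fin T,
          ((circulantMatrix (fun t => -g t) T).submatrix p q).det =
            -((circulantMatrix g T).submatrix p q).det := fun p q => by
        rw [det_circulantMatrix_submatrix, toeplitzMinor_neg_odd, det_circulantMatrix_submatrix]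
      intro p q
      rw [← neg_nonneg, ← hneg]
      refine det_circulantMatrix_submatrix_nonneg (g := fun t => -g t) hk_le
        (fun t => by simp only [hg t]) (fun q => ?_) p q
      rw [hneg, neg_nonneg, ← hrows (RelEmbedding.refl _)]
      exact h _ q
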